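/- **Setting.** Let $\mathcal X=\{1,\dots,k\}$, $h:\mathcal X\to\mathbb R^d$, and let $\mathsf T=\{v\in\mathbb R^k:\sum_x v_x=0,\ \sum_x v_x h(x)=0\}\neq\{0\}$. Assume that $\mathsf T$ is spanned by integer vectors (automatic if $h$ is rational-valued). A *model* consists of a strictly positive probability law $Q$ on $\mathcal X$ and a target $\alpha\in\mathbb R^d$. Its feasible set is $E=\{P: P(x)>0\ \forall x,\ \sum_x P(x)=1,\ \mathbb E_P h=\alpha\}$, and $P^*=\arg\min_{P\in E}D(P\|Q)$ is its information projection, where $D(P\|Q)=\sum_xP(x)\log\frac{P(x)}{Q(x)}$. Its curvature is the smallest eigenvalue $\lambda_{\min}(H^*)$ of $H^*=\Pi\,\mathrm{diag}(1/P^*)\,\Pi$ on $\mathsf T$, where $\Pi$ is the Euclidean orthogonal projection onto $\mathsf T$. Let $E_n$ be the set of empirical laws of samples of size $n$ (types) that lie in $E$. For $T>0$ the *tempered posterior* $\pi_T$ on $E_n$ gives $P$ a weight proportional to $\Pr_{Q^{\otimes n}}(P_n=P)^{1/T}$, where $P_n$ is the empirical law of $n$ i.i.d. draws from $Q$. The *tempered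 predictive law* is $$\mu^T_{n,m}(y)=\sum_{P\in E_n}\Pr(X_{1:m}=y\mid P_n=P)\,\pi_T(P),\qquad y\in\mathcal X^m,$$ with $\Pr(\cdot\mid P_n=P)$ sampling without replacement from $P$. For $T=1$ these are the conditional laws of $P_n$ and of $X_{1:m}$ given $P_n\in E_n$. Let $\mathcal M$ be a family of models with the same $h$ and with $\min_xP^*(x)\ge\delta$ for a common $\delta>0$. For each model and each $n$ let $\widehat\lambda_n$ be a random variable on a probability space (which may depend on the model and on $n$), such that for every $\varepsilon>0$ the probability of $|\widehat\lambda_n-\lambda_{\min}(H^*)|\ge\varepsilon$ tends to $0$ uniformly over $\mathcal M$ (for a single model this is consistency). "With high probability" means that the probability of the complement, among the models of $\mathcal M$ with $E_n\ne\emptyset$, tends to $0$ as $n\to\infty$, uniformly over $\mathcal M$. **Proposition.** 1. Let $0<\ell\le u$ and $0<a\le b$. There is a constant $C$ depending only on $(k,\ell,u,a,b)$ such that, for all $h$, $\delta$, $\mathcal M$ and $\widehat\lambda_n$ as above with $\ell\le\lambda_{\min}(H^*)\le u$ for every model of $\mathcal M$, and for all random temperatures $T_n$ for which the probability of $T_n/\widehat\lambda_n\notin[a,b]$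 tends to $0$ uniformly over $\mathcal M$, with high probability $$\big\|\mu^{T_n}_{n,m}-(P^*)^{\otimes m}\big\|_{\mathrm{TV}}\le C\,m\sqrt{\frac{\log n}{n}}\qquad\text{for all } 0\le m\le n .$$ 2. Let $\beta,\lambda_0>0$ and $T(x)=1+\beta\log(1+x/\lambda_0)$. On every interval $[\ell,u]$ with $0<\ell\le u$, $T(x)/x$ is bounded above and away from zero. Moreover there is a constant $C$ depending only on $(k,\beta,\lambda_0)$, and not on the curvature, such that for all $h$, $\delta$, $\mathcal M$ and $\widehat\lambda_n$ as above and $T_n=T(\widehat\lambda_n)$: * (stable rates) with high probability $\|\mu^{T_n}_{n,m}-(P^*)^{\otimes m}\|_{\mathrm{TV}}\le C\,m\sqrt{\log n/n}$ for all $0\le m\le n$; * (predictive calibration) if $m_n\sqrt{\log n/n}\to0$, then for every $\varepsilon>0$, with high probability, for all $S\subseteq\mathcal X^{m_n}$ the tempered predictive probability $\mu^{T_n}_{n,m_n}(S)$ differs by at most $\varepsilon$ from the actual conditional probability $\mu^{1}_{n,m_n}(S)$ and from $(P^*)^{\otimes m_n}(S)$; * (credible regions) with high probability, for every $t\in\mathbb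 R$ the highest-density region $R=\{P\in E_n:\pi_{T_n}(P)\ge t\}$ satisfies $\pi_1(R)\ge\pi_{T_n}(R)$: its actual conditional coverage is at least its nominal level. -/

import Mathlib

open Filter Topology MeasureTheory
open scoped ENNReal

noncomputable section

namespace Tempering

/-! ### Laws on a finite sample space, moment constraints, information projection -/

/-- The open probability simplex on the sample space `Fin k`. -/
def openSimplex (k : ℕ) : Set (Fin k → ℝ) :=
  {P | (∀ x, 0 < P x) ∧ ∑ x, P x = 1}

/-- The feasible set `E`: strictly positive laws `P` with `𝔼_P[h(X)] = α`, for the feature map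
`h : Fin k → ℝᵈ`. -/
def feasibleSet {k d : ℕ} (h : Fin k → Fin d → ℝ) (α : Fin d → ℝ) : Set (Fin k → ℝ) :=
  {P | P ∈ openSimplex k ∧ ∀ j, ∑ x, P x * h x j = α j}

/-- Kullback--Leibler divergence `D(P‖Q) = ∑ₓ P(x) log (P(x)/Q(x))` (used for positive laws). -/
def klDiv {k : ℕ} (P Q : Fin k → ℝ) : ℝ :=
  ∑ x, P x * Real.log (P x / Q x)

/-- `P` is the information projection of `Q` onto the feasible set:
`P` is the minimiser of `D(· ‖ Q)` over `E`. -/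
def IsInfoProjection {k d : ℕ} (h : Fin k → Fin d → ℝ) (α : Fin d → ℝ)
    (Q P : Fin k → ℝ) : Prop :=
  P ∈ feasibleSet h α ∧ ∀ P' ∈ feasibleSet h α, klDiv P Q ≤ klDiv P' Q

/-- The constrained model with features `h`, targets `α` and strictly positive reference law `Q`
has information projection `P`, and every cell of `P` has probability at least `δ`. -/
def IsModel {k d : ℕ} (h : Fin k → Fin d → ℝ) (δ : ℝ) (Q : Fin k → ℝ) (α : Fin d → ℝ)
    (P : Fin k → ℝ) : Prop :=
  Q ∈ openSimplex k ∧ IsInfoProjection h α Q P ∧ ∀ x, δ ≤ P x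

/-! ### Tangent space and curvature -/

/-- The tangent space `{v | ∑ₓ v(x) = 0, A v = 0}`, with `A = [h(1) ⋯ h(k)]`, as a subspace of
Euclidean space. -/
def tangentSpace {k d : ℕ} (h : Fin k → Fin d → ℝ) : Submodule ℝ (EuclideanSpace ℝ (Fin k)) where
  carrier := {v | ∑ x, v x = 0 ∧ ∀ j, ∑ x, v x * h x j = 0}
  add_mem' := by
    rintro v w ⟨hv, hv'⟩ ⟨hw, hw'⟩
    refine ⟨?_, fun j => ?_⟩
    · simp [Finset.sum_add_distrib, hv, hw]
    · simp [add_mul, Finset.sum_add_distrib, hv' j, hw' j]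
  zero_mem' := by simp
  smul_mem' := by
    rintro c v ⟨hv, hv'⟩
    refine ⟨?_, fun j => ?_⟩
    · simp [← Finset.mul_sum, hv]
    · simp [mul_assoc, ← Finset.mul_sum, hv' j]

/-- The feature map is a lattice feature map: the tangent space is spanned over `ℝ` by the
vectors with integer coordinates that it contains (automatic when `h` has rational values). -/
def IsLatticeFeature {k d : ℕ} (h : Fin k → Fin d → ℝ) : Prop :=
  Submodule.span ℝ {v : EuclideanSpace ℝ (Fin k) | v ∈ tangentSpace h ∧ ∀ x, ∃ z : ℤ, v x = z}
    = tangentSpace h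

/-- The projected Hessian `H* = Π diag(1/P) Π`, as an operator on the tangent space, where `Π` is
the Euclidean orthogonal projection onto the tangent space. -/
def curvatureOperator {k d : ℕ} (h : Fin k → Fin d → ℝ) (P : Fin k → ℝ) :
    Module.End ℝ (tangentSpace h) :=
  (tangentSpace h).orthogonalProjectionOnto.toLinearMap ∘ₗ
    Matrix.toEuclideanLin (Matrix.diagonal fun x => 1 / P x) ∘ₗ (tangentSpace h).subtype

/-- The smallest eigenvalue `λ_min(H*)`. -/
def lambdaMin {k d : ℕ} (h : Fin k → Fin d → ℝ) (P : Fin k → ℝ) : ℝ :=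
  sInf {μ : ℝ | (curvatureOperator h P).HasEigenvalue μ}

/-! ### Empirical types and the tempered posterior -/

/-- The empirical law `c / n` of a sample of size `n` with cell counts `c`. -/
def typeLaw {k : ℕ} (n : ℕ) (c : Fin k → ℕ) : Fin k → ℝ := fun x => (c x : ℝ) / n

open Classical in
/-- The feasible types `E_n = E ∩ 𝒫_n`, each given by its vector of cell counts. -/
def feasibleTypes {k d : ℕ} (h : Fin k → Fin d → ℝ) (α : Fin d → ℝ) (n : ℕ) :
    Finset (Fin k → ℕ) :=
  (Finset.piAntidiag Finset.univ n).filter fun c => typeLaw n c ∈ feasibleSet h α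

/-- The multinomial likelihood `Pr(P_n = c/n)` of a type under i.i.d. sampling from `Q`. -/
def typeProb {k : ℕ} (Q : Fin k → ℝ) (c : Fin k → ℕ) : ℝ :=
  (Nat.multinomial Finset.univ c : ℝ) * ∏ x, Q x ^ c x

/-- The tempered posterior at temperature `T`: the weights of the feasible types are the
multinomial likelihoods raised to the power `1/T`, normalised over `E_n`. At `T = 1` this is
`Pr(P_n = c/n ∣ P_n ∈ E_n)`. -/
def temperedPosterior {k d : ℕ} (h : Fin k → Fin d → ℝ) (α : Fin d → ℝ) (Q : Fin k → ℝ)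
    (T : ℝ) (n : ℕ) (c : Fin k → ℕ) : ℝ :=
  typeProb Q c ^ (1 / T) / ∑ c' ∈ feasibleTypes h α n, typeProb Q c' ^ (1 / T)

/-- The number of occurrences of the symbol `x` in the word `y`. -/
def symbolCount {k m : ℕ} (y : Fin m → Fin k) (x : Fin k) : ℕ :=
  (Finset.univ.filter fun i => y i = x).card

/-- `Pr(X_{1:m} = y ∣ P_n = c/n)`: sampling `m` times without replacement from an urn of `n` balls
of which `c x` carry the symbol `x`. -/
def hypergeometricLaw {k : ℕ} (n m : ℕ) (c : Fin k → ℕ) (y : Fin m → Fin k) : ℝ :=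
  (∏ x, ((c x).descFactorial (symbolCount y x) : ℝ)) / (n.descFactorial m : ℝ)

/-- The tempered predictive law of `m` observations: the mixture of the conditional laws given the
type, under the tempered posterior. At `T = 1` this is the constrained predictive law
`μ_{n,m} = ℒ(X_{1:m} ∣ P_n ∈ E_n)`. -/
def temperedPredictive {k d : ℕ} (h : Fin k → Fin d → ℝ) (α : Fin d → ℝ) (Q : Fin k → ℝ)
    (T : ℝ) (n m : ℕ) (y : Fin m → Fin k) : ℝ :=
  ∑ c ∈ feasibleTypes h α n, hypergeometricLaw n m c y * temperedPosterior h α Q T n c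

/-- The product law `P^{⊗m}`. -/
def productLaw {k : ℕ} (P : Fin k → ℝ) (m : ℕ) (y : Fin m → Fin k) : ℝ := ∏ i, P (y i)

/-- Total variation distance (half the `ℓ¹` distance) between two laws on a finite set. -/
def tvDist {S : Type*} [Fintype S] (μ ν : S → ℝ) : ℝ := (∑ s, |μ s - ν s|) / 2

open Classical in
/-- The highest-posterior-density region of the tempered posterior with density threshold `t`. -/
def hpdRegion {k d : ℕ} (h : Fin k → Fin d → ℝ) (α : Fin d → ℝ) (Q : Fin k → ℝ)
    (T : ℝ) (n : ℕ) (t : ℝ) : Finset (Fin k → ℕ) :=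
  (feasibleTypes h α n).filter fun c => t ≤ temperedPosterior h α Q T n c

/-! ### Temperature and estimated curvature -/

/-- The curvature-adaptive temperature `T(x) = 1 + β log(1 + x/λ₀)`. -/
def logTemperature (β lam0 x : ℝ) : ℝ := 1 + β * Real.log (1 + x / lam0)

/-- The probabilities of the events `B i n` tend to zero as `n → ∞`, uniformly in the model `i`. -/
def UniformlyNegligible {ι : Type*} {Ω : ι → ℕ → Type*} [∀ i n, MeasurableSpace (Ω i n)]
    (ℙ : ∀ i n, Measure (Ω i n)) (B : ∀ i n, Set (Ω i n)) : Prop :=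
  ∀ η : ℝ≥0∞, 0 < η → ∀ᶠ n in atTop, ∀ i, ℙ i n (B i n) ≤ η

/-- `est` is consistent for the curvatures `lam`, uniformly over the models `i`. -/
def IsConsistent {ι : Type*} {Ω : ι → ℕ → Type*} [∀ i n, MeasurableSpace (Ω i n)]
    (ℙ : ∀ i n, Measure (Ω i n)) (est : ∀ i n, Ω i n → ℝ) (lam : ι → ℝ) : Prop :=
  ∀ ε : ℝ, 0 < ε → UniformlyNegligible ℙ fun i n => {ω | ε ≤ |est i n ω - lam i|}

/-- At sample size `n` the tempered predictive laws collapse onto `P^{⊗m}` at the rate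
`C m √(log n / n)`, for all horizons `m ≤ n`. -/
def CollapseBound {k d : ℕ} (h : Fin k → Fin d → ℝ) (α : Fin d → ℝ) (Q P : Fin k → ℝ)
    (T C : ℝ) (n : ℕ) : Prop :=
  ∀ m ≤ n, tvDist (temperedPredictive h α Q T n m) (productLaw P m)
    ≤ C * (m * Real.sqrt (Real.log n / n))

end Tempering

end

namespace Tempering

/-! ### Curvature -/

/-! The core is a cancellation. The temperature enters through `T ≤ K λ`, the curvature `λ =
λ_min(H*)` through a quadratic lower bound for the divergence, and `λ` drops out of the rate.

The first-order condition at `P*` gives the Pythagorean identity `D(P‖Q) = D(P‖P*) + D(P*‖Q)` on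
`E`, so the posterior is unchanged when `Q` is replaced by `P*` (`exists_typeProb_eq_mul`). By the
method of types the likelihood of `c` under `P*` is `exp(-n D(c/n‖P*))` up to a factor `(n+1)^k`.
Rounding in an integer basis of the tangent space produces a feasible type within `O(1/n)` of `P*`
(`exists_feasibleType_near`), for which `n D ≤ 1` once `n` is large. Compared with it, a type with
`n D ≥ (2k+1)(1+T) log n` has posterior weight at most `n^{-(2k+1)}`, and there are at most `n^{2k}`
types. Near `P*` one has `D ≥ (λ/6)|P - P*|²`, and `1 + T ≤ (1+K) λ` because `λ ≥ 1`. Hence the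
posterior concentrates at distance `√(log n / n)`, with a constant depending on `k` and `K` only
(`le_mul_klDiv_of_far`, `sum_temperedPosterior_mul_dist_le`); `δ` and `h` only affect how large `n`
must be. Passing to `m` draws costs `m` times this distance, plus `m²/n` for the missing replacement
(`collapseBound_of_le`).

When `|λ̂ - λ| < 1`, the temperatures of both parts satisfy `T ≤ K λ`, and so does `T = 1` if `K ≥
1`; calibration compares two laws that both collapse onto `P*^{⊗m}`. Coverage needs no asymptotics
beyond `T ≥ 1`: `π_1/π_T` is proportional to the likelihood to the power `1 - 1/T`, so it is
nondecreasing in the density of `π_T` (`sum_hpdRegion_le`). -/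

lemma inner_curvatureOperator {k d : ℕ} (h : Fin k → Fin d → ℝ) (P : Fin k → ℝ)
    (v w : tangentSpace h) :
    inner ℝ (curvatureOperator h P v) w
      = ∑ x, (v : EuclideanSpace ℝ (Fin k)) x * (w : EuclideanSpace ℝ (Fin k)) x / P x := by
  rw [curvatureOperator]
  simp only [LinearMap.comp_apply, ContinuousLinearMap.coe_coe, Submodule.subtype_apply]
  rw [Submodule.inner_orthogonalProjectionOnto_eq_of_mem_right, PiLp.inner_apply]
  refine Finset.sum_congr rfl fun x _ => ?_
  simp [Matrix.toLpLin_apply, Matrix.mulVec_diagonal]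
  ring

lemma isSymmetric_curvatureOperator {k d : ℕ} (h : Fin k → Fin d → ℝ) (P : Fin k → ℝ) :
    (curvatureOperator h P).IsSymmetric := by
  intro v w
  rw [inner_curvatureOperator, real_inner_comm, inner_curvatureOperator]
  exact Finset.sum_congr rfl fun x _ => by ring

lemma norm_sq_tangentSpace {k d : ℕ} {h : Fin k → Fin d → ℝ} (v : tangentSpace h) :
    ‖v‖ ^ 2 = ∑ x, (v : EuclideanSpace ℝ (Fin k)) x ^ 2 := by
  rw [show ‖v‖ = ‖(v : EuclideanSpace ℝ (Fin k))‖ from rfl, EuclideanSpace.norm_sq_eq]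
  simp

lemma norm_sq_le_inner_curvatureOperator {k d : ℕ} (h : Fin k → Fin d → ℝ) {P : Fin k → ℝ}
    (hP0 : ∀ x, 0 < P x) (hP1 : ∀ x, P x ≤ 1) (v : tangentSpace h) :
    ‖v‖ ^ 2 ≤ inner ℝ (curvatureOperator h P v) v := by
  rw [inner_curvatureOperator, norm_sq_tangentSpace]
  refine Finset.sum_le_sum fun x _ => ?_
  rw [le_div_iff₀ (hP0 x), ← sq]
  exact mul_le_of_le_one_right (sq_nonneg _) (hP1 x)

lemma inner_curvatureOperator_le {k d : ℕ} (h : Fin k → Fin d → ℝ) {P : Fin k → ℝ} {δ : ℝ}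
    (hδ : 0 < δ) (hP : ∀ x, δ ≤ P x) (v : tangentSpace h) :
    inner ℝ (curvatureOperator h P v) v ≤ 1 / δ * ‖v‖ ^ 2 := by
  rw [inner_curvatureOperator, norm_sq_tangentSpace, Finset.mul_sum]
  refine Finset.sum_le_sum fun x _ => ?_
  rw [← sq, div_eq_mul_inv, mul_comm, ← one_div]
  exact mul_le_mul_of_nonneg_right (one_div_le_one_div_of_le hδ (hP x)) (sq_nonneg _)

lemma exists_inner_eq_of_hasEigenvalue {k d : ℕ} {h : Fin k → Fin d → ℝ} {P : Fin k → ℝ} {μ : ℝ}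
    (hμ : (curvatureOperator h P).HasEigenvalue μ) :
    ∃ v : tangentSpace h, 0 < ‖v‖ ^ 2 ∧ inner ℝ (curvatureOperator h P v) v = μ * ‖v‖ ^ 2 := by
  obtain ⟨v, hv⟩ := hμ.exists_hasEigenvector
  refine ⟨v, by have := norm_pos_iff.2 hv.2; positivity, ?_⟩
  rw [hv.apply_eq_smul, real_inner_smul_left, real_inner_self_eq_norm_sq]

lemma one_le_of_hasEigenvalue {k d : ℕ} {h : Fin k → Fin d → ℝ} {P : Fin k → ℝ}
    (hP0 : ∀ x, 0 < P x) (hP1 : ∀ x, P x ≤ 1) {μ : ℝ}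
    (hμ : (curvatureOperator h P).HasEigenvalue μ) : 1 ≤ μ := by
  obtain ⟨v, hv, hμv⟩ := exists_inner_eq_of_hasEigenvalue hμ
  have := norm_sq_le_inner_curvatureOperator h hP0 hP1 v
  rw [hμv] at this
  exact le_of_mul_le_mul_right (by linarith) hv

/-- The infimum of the Rayleigh quotient of a symmetric operator on a nonzero finite-dimensional
space is an eigenvalue. In particular the set in `lambdaMin` is nonempty, so its `sInf` is not the
default value. -/
lemma exists_hasEigenvalue_curvatureOperator {k d : ℕ} {h : Fin k → Fin d → ℝ}
    (hT : tangentSpace h ≠ ⊥) {P : Fin k → ℝ} (hP0 : ∀ x, 0 < P x) :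
    ∃ μ, (curvatureOperator h P).HasEigenvalue μ ∧
      ∀ v : tangentSpace h, μ * ‖v‖ ^ 2 ≤ inner ℝ (curvatureOperator h P v) v := by
  have : Nontrivial (tangentSpace h) := Submodule.nontrivial_iff_ne_bot.2 hT
  refine ⟨_, (isSymmetric_curvatureOperator h P).hasEigenvalue_iInf_of_finiteDimensional,
    fun v => ?_⟩
  rcases eq_or_ne v 0 with rfl | hv
  · simp
  have hv2 : 0 < ‖v‖ ^ 2 := by have := norm_pos_iff.2 hv; positivity
  rw [← le_div_iff₀ hv2]
  refine ciInf_le (f := fun x : {x : tangentSpace h // x ≠ 0} =>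
    RCLike.re (inner ℝ (curvatureOperator h P x) (x : tangentSpace h)) / ‖(x : tangentSpace h)‖ ^ 2)
    ⟨0, ?_⟩ ⟨v, hv⟩
  rintro _ ⟨w, rfl⟩
  simp only [inner_curvatureOperator, RCLike.re_to_real]
  refine div_nonneg (Finset.sum_nonneg fun x _ => ?_) (sq_nonneg _)
  exact div_nonneg (mul_self_nonneg _) (hP0 x).le

lemma le_one_of_mem_openSimplex {k : ℕ} {P : Fin k → ℝ} (hP : P ∈ openSimplex k) (x : Fin k) :
    P x ≤ 1 :=
  hP.2 ▸ Finset.single_le_sum (f := P) (fun y _ => (hP.1 y).le) (Finset.mem_univ x)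

/-- As `P ≤ 1`, the matrix `diag(1/P)` dominates the identity. This bound lets `λ_min` absorb
additive constants, as in `1 + T ≤ (1 + K) λ_min`. -/
lemma one_le_lambdaMin {k d : ℕ} {h : Fin k → Fin d → ℝ} (hT : tangentSpace h ≠ ⊥)
    {P : Fin k → ℝ} (hP : P ∈ openSimplex k) : 1 ≤ lambdaMin h P := by
  obtain ⟨μ, hμ, -⟩ := exists_hasEigenvalue_curvatureOperator hT hP.1
  exact le_csInf ⟨μ, hμ⟩ fun ν hν =>
    one_le_of_hasEigenvalue hP.1 (le_one_of_mem_openSimplex hP) hν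

lemma lambdaMin_le_of_hasEigenvalue {k d : ℕ} {h : Fin k → Fin d → ℝ} {P : Fin k → ℝ}
    (hP : P ∈ openSimplex k) {μ : ℝ} (hμ : (curvatureOperator h P).HasEigenvalue μ) :
    lambdaMin h P ≤ μ :=
  csInf_le ⟨1, fun _ hν => one_le_of_hasEigenvalue hP.1 (le_one_of_mem_openSimplex hP) hν⟩ hμ

lemma lambdaMin_le_one_div {k d : ℕ} {h : Fin k → Fin d → ℝ} (hT : tangentSpace h ≠ ⊥)
    {P : Fin k → ℝ} (hP : P ∈ openSimplex k) {δ : ℝ} (hδ : 0 < δ) (hPδ : ∀ x, δ ≤ P x) :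
    lambdaMin h P ≤ 1 / δ := by
  obtain ⟨μ, hμ, -⟩ := exists_hasEigenvalue_curvatureOperator hT hP.1
  refine (lambdaMin_le_of_hasEigenvalue hP hμ).trans ?_
  obtain ⟨v, hv, hμv⟩ := exists_inner_eq_of_hasEigenvalue hμ
  exact le_of_mul_le_mul_right (hμv ▸ inner_curvatureOperator_le h hδ hPδ v) hv

/-- The smallest eigenvalue bounds the quadratic form of the curvature from below. -/
lemma lambdaMin_mul_sum_sq_le {k d : ℕ} {h : Fin k → Fin d → ℝ} (hT : tangentSpace h ≠ ⊥)
    {P : Fin k → ℝ} (hP : P ∈ openSimplex k) {v : Fin k → ℝ} (hv : ∑ x, v x = 0)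
    (hvh : ∀ j, ∑ x, v x * h x j = 0) :
    lambdaMin h P * ∑ x, v x ^ 2 ≤ ∑ x, v x ^ 2 / P x := by
  obtain ⟨μ, hμ, hle⟩ := exists_hasEigenvalue_curvatureOperator hT hP.1
  have key := hle ⟨WithLp.toLp 2 v, hv, hvh⟩
  rw [norm_sq_tangentSpace, inner_curvatureOperator] at key
  calc lambdaMin h P * ∑ x, v x ^ 2 ≤ μ * ∑ x, v x ^ 2 :=
        mul_le_mul_of_nonneg_right (lambdaMin_le_of_hasEigenvalue hP hμ)
          (Finset.sum_nonneg fun x _ => sq_nonneg _)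
    _ ≤ ∑ x, v x * v x / P x := key
    _ = _ := Finset.sum_congr rfl fun x _ => by rw [sq]

/-! ### First-order condition for the information projection -/

lemma sub_tangent_of_mem_feasibleSet {k d : ℕ} {h : Fin k → Fin d → ℝ} {α : Fin d → ℝ}
    {P P' : Fin k → ℝ} (hP : P ∈ feasibleSet h α) (hP' : P' ∈ feasibleSet h α) :
    ∑ x, (P' x - P x) = 0 ∧ ∀ j, ∑ x, (P' x - P x) * h x j = 0 := by
  refine ⟨?_, fun j => ?_⟩
  · rw [Finset.sum_sub_distrib, hP'.1.2, hP.1.2, sub_self]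
  · simp only [sub_mul]
    rw [Finset.sum_sub_distrib, hP'.2 j, hP.2 j, sub_self]

lemma hasDerivAt_klDiv_add_smul {k : ℕ} {P Q : Fin k → ℝ} (hP : ∀ x, 0 < P x)
    (hQ : ∀ x, 0 < Q x) (v : Fin k → ℝ) :
    HasDerivAt (fun t : ℝ => klDiv (fun x => P x + t * v x) Q)
      (∑ x, (v x * Real.log (P x / Q x) + v x)) 0 := by
  unfold klDiv
  refine HasDerivAt.fun_sum fun x _ => ?_
  have h1 : HasDerivAt (fun t : ℝ => P x + t * v x) (v x) 0 := by
    simpa using ((hasDerivAt_id (0 : ℝ)).mul_const (v x)).const_add (P x)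
  have h2 := (h1.div_const (Q x)).log (by simpa using ⟨(hP x).ne', (hQ x).ne'⟩)
  have hx := (hP x).ne'
  have hx' := (hQ x).ne'
  refine (h1.mul h2).congr_deriv ?_
  rw [zero_mul, add_zero]
  field_simp

/-- Positivity is an open condition, so `P + t v` stays feasible for small `t` of either sign, and
the derivative of the divergence along `v` vanishes at `t = 0`. -/
lemma sum_mul_log_infoProjection_eq_zero {k d : ℕ} {h : Fin k → Fin d → ℝ} {α : Fin d → ℝ}
    {Q P : Fin k → ℝ} (hQ : Q ∈ openSimplex k) (hP : IsInfoProjection h α Q P) {v : Fin k → ℝ}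
    (hv : ∑ x, v x = 0) (hvh : ∀ j, ∑ x, v x * h x j = 0) :
    ∑ x, v x * Real.log (P x / Q x) = 0 := by
  have hmin : IsLocalMin (fun t : ℝ => klDiv (fun x => P x + t * v x) Q) 0 := by
    have hpos : ∀ᶠ t : ℝ in 𝓝 0, ∀ x, 0 < P x + t * v x := by
      rw [eventually_all]
      intro x
      have hc : ContinuousAt (fun t : ℝ => P x + t * v x) 0 := by fun_prop
      exact hc.eventually (lt_mem_nhds (by simpa using hP.1.1.1 x))
    filter_upwards [hpos] with t ht
    simp only [zero_mul, add_zero]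
    refine hP.2 _ ⟨⟨ht, ?_⟩, fun j => ?_⟩
    · rw [Finset.sum_add_distrib, ← Finset.mul_sum, hv, hP.1.1.2, mul_zero, add_zero]
    · simp only [add_mul, mul_assoc]
      rw [Finset.sum_add_distrib, ← Finset.mul_sum, hvh j, hP.1.2 j, mul_zero, add_zero]
  have := hmin.hasDerivAt_eq_zero (hasDerivAt_klDiv_add_smul hP.1.1.1 hQ.1 v)
  rwa [Finset.sum_add_distrib, hv, add_zero] at this

/-! ### Elementary bounds for the divergence -/

/-- With `p = a²` and `q = b²`, the inequality `log r ≤ r - 1` at `r = b/a` bounds the right side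
below by the Hellinger term `(a - b)²`; then `(a + b)² ≤ 2(a² + b²)`. -/
lemma sq_div_le_mul_log_div {p q : ℝ} (hp : 0 < p) (hq : 0 < q) :
    (p - q) ^ 2 / (2 * (p + q)) ≤ p * Real.log (p / q) - p + q := by
  obtain ⟨a, ha, rfl⟩ : ∃ a : ℝ, 0 < a ∧ p = a ^ 2 :=
    ⟨√p, Real.sqrt_pos.2 hp, (Real.sq_sqrt hp.le).symm⟩
  obtain ⟨b, hb, rfl⟩ : ∃ b : ℝ, 0 < b ∧ q = b ^ 2 :=
    ⟨√q, Real.sqrt_pos.2 hq, (Real.sq_sqrt hq.le).symm⟩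
  have hlog : Real.log (a ^ 2 / b ^ 2) = -2 * Real.log (b / a) := by
    rw [← div_pow, Real.log_pow, ← inv_div, Real.log_inv]
    push_cast
    ring
  have h1 : (a - b) ^ 2 ≤ a ^ 2 * Real.log (a ^ 2 / b ^ 2) - a ^ 2 + b ^ 2 := by
    have h2 := mul_le_mul_of_nonneg_left (Real.log_le_sub_one_of_pos (div_pos hb ha)) (sq_nonneg a)
    have h3 : a ^ 2 * (b / a - 1) = a * b - a ^ 2 := by field_simp
    rw [hlog]
    nlinarith
  refine le_trans ?_ h1
  rw [div_le_iff₀ (by positivity)]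
  nlinarith [mul_nonneg (sq_nonneg (a - b)) (sq_nonneg (a - b))]

/-- The correction `-P + Q` sums to zero and makes every summand nonnegative, so the divergence can
be bounded termwise. -/
lemma klDiv_eq_sum {k : ℕ} {P Q : Fin k → ℝ} (hP : ∑ x, P x = 1) (hQ : ∑ x, Q x = 1) :
    klDiv P Q = ∑ x, (P x * Real.log (P x / Q x) - P x + Q x) := by
  rw [Finset.sum_add_distrib, Finset.sum_sub_distrib, hP, hQ, klDiv]
  ring

lemma sum_sq_div_le_klDiv {k : ℕ} {P Q : Fin k → ℝ} (hP : P ∈ openSimplex k)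
    (hQ : Q ∈ openSimplex k) : ∑ x, (P x - Q x) ^ 2 / (2 * (P x + Q x)) ≤ klDiv P Q := by
  rw [klDiv_eq_sum hP.2 hQ.2]
  exact Finset.sum_le_sum fun x _ => sq_div_le_mul_log_div (hP.1 x) (hQ.1 x)

/-- Near the reference law the divergence is bounded below by the chi-square distance. -/
lemma sum_sq_div_le_klDiv_of_le {k : ℕ} {P Q : Fin k → ℝ} (hP : P ∈ openSimplex k)
    (hQ : Q ∈ openSimplex k) (hPQ : ∀ x, P x ≤ 2 * Q x) :
    (∑ x, (P x - Q x) ^ 2 / Q x) / 6 ≤ klDiv P Q := by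
  refine le_trans ?_ (sum_sq_div_le_klDiv hP hQ)
  rw [Finset.sum_div]
  refine Finset.sum_le_sum fun x _ => ?_
  rw [div_div]
  have := hP.1 x
  have := hQ.1 x
  exact div_le_div_of_nonneg_left (sq_nonneg _) (by linarith) (by linarith [hPQ x])

lemma sq_sub_div_le_klDiv {k : ℕ} {P Q : Fin k → ℝ} (hP : P ∈ openSimplex k)
    (hQ : Q ∈ openSimplex k) (x : Fin k) : (P x - Q x) ^ 2 / 4 ≤ klDiv P Q := by
  refine le_trans ?_ (sum_sq_div_le_klDiv hP hQ)
  have hpos : ∀ y, 0 < 2 * (P y + Q y) := fun y => by have := hP.1 y; have := hQ.1 y; linarith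
  refine le_trans ?_ (Finset.single_le_sum (f := fun y => (P y - Q y) ^ 2 / (2 * (P y + Q y)))
    (fun y _ => div_nonneg (sq_nonneg _) (hpos y).le) (Finset.mem_univ x))
  refine div_le_div_of_nonneg_left (sq_nonneg _) (hpos x) ?_
  linarith [le_one_of_mem_openSimplex hP x, le_one_of_mem_openSimplex hQ x]

lemma klDiv_le_sum_sq_div {k : ℕ} {P Q : Fin k → ℝ} (hP : P ∈ openSimplex k)
    (hQ : Q ∈ openSimplex k) : klDiv P Q ≤ ∑ x, (P x - Q x) ^ 2 / Q x := by
  rw [klDiv_eq_sum hP.2 hQ.2]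
  refine Finset.sum_le_sum fun x _ => ?_
  have hp := hP.1 x
  have hq := hQ.1 x
  have h1 := mul_le_mul_of_nonneg_left (Real.log_le_sub_one_of_pos (div_pos hp hq)) hp.le
  have h2 : (P x - Q x) ^ 2 / Q x = P x * (P x / Q x - 1) - P x + Q x := by
    field_simp
    ring
  linarith

/-! ### Multinomial probabilities of types -/

lemma mem_feasibleTypes {k d : ℕ} {h : Fin k → Fin d → ℝ} {α : Fin d → ℝ} {n : ℕ}
    {c : Fin k → ℕ} :
    c ∈ feasibleTypes h α n ↔ ∑ x, c x = n ∧ typeLaw n c ∈ feasibleSet h α := by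
  simp [feasibleTypes]

/-- If `a ≤ b`, then `b!/a!` has `b - a` factors, each at least `a`; if `b ≤ a`, then `a!/b!` has `a
- b` factors, each at most `a`. -/
lemma factorial_mul_pow_le (a b : ℕ) :
    a.factorial * a ^ b ≤ b.factorial * a ^ a := by
  rcases le_total a b with hab | hba
  · calc a.factorial * a ^ b = (a.factorial * a ^ (b - a)) * a ^ a := by
          rw [mul_assoc, ← pow_add, Nat.sub_add_cancel hab]
      _ ≤ _ := Nat.mul_le_mul_right _ (Nat.factorial_mul_pow_sub_le_factorial hab)
  · have h1 : a.factorial ≤ b.factorial * a ^ (a - b) := by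
      have h2 := Nat.factorial_mul_descFactorial (n := a) (k := a - b) (Nat.sub_le _ _)
      rw [Nat.sub_sub_self hba] at h2
      rw [← h2]
      exact Nat.mul_le_mul_left _ (Nat.descFactorial_le_pow _ _)
    calc a.factorial * a ^ b ≤ b.factorial * a ^ (a - b) * a ^ b := Nat.mul_le_mul_right _ h1
      _ = _ := by rw [mul_assoc, ← pow_add, Nat.sub_add_cancel hba]

/-- Under i.i.d. sampling from the type `c / n`, the type `c` itself is the most likely one. -/
lemma multinomial_mul_prod_pow_le {k : ℕ} {c c' : Fin k → ℕ} (hcc : ∑ x, c x = ∑ x, c' x) :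
    Nat.multinomial Finset.univ c' * ∏ x, c x ^ c' x
      ≤ Nat.multinomial Finset.univ c * ∏ x, c x ^ c x := by
  have h1 := Nat.multinomial_spec Finset.univ c
  have h2 := Nat.multinomial_spec Finset.univ c'
  rw [← hcc, ← h1] at h2
  have hpos : 0 < (∏ x, (c x).factorial) * ∏ x, (c' x).factorial :=
    Nat.mul_pos (Finset.prod_pos fun x _ => Nat.factorial_pos _)
      (Finset.prod_pos fun x _ => Nat.factorial_pos _)
  refine Nat.le_of_mul_le_mul_left ?_ hpos
  have h3 : (∏ x, (c x).factorial) * ∏ x, c x ^ c' x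
      ≤ (∏ x, (c' x).factorial) * ∏ x, c x ^ c x := by
    rw [← Finset.prod_mul_distrib, ← Finset.prod_mul_distrib]
    exact Finset.prod_le_prod' fun x _ => factorial_mul_pow_le _ _
  calc (∏ x, (c x).factorial) * (∏ x, (c' x).factorial) *
        (Nat.multinomial Finset.univ c' * ∏ x, c x ^ c' x)
      = ((∏ x, (c' x).factorial) * Nat.multinomial Finset.univ c') *
        ((∏ x, (c x).factorial) * ∏ x, c x ^ c' x) := by ring
    _ ≤ ((∏ x, (c x).factorial) * Nat.multinomial Finset.univ c) *
        ((∏ x, (c' x).factorial) * ∏ x, c x ^ c x) := by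
        rw [h2]; exact Nat.mul_le_mul_left _ h3
    _ = _ := by ring

lemma card_piAntidiag_le (k n : ℕ) :
    (Finset.piAntidiag (Finset.univ : Finset (Fin k)) n).card ≤ (n + 1) ^ k := by
  calc _ ≤ (Fintype.piFinset fun _ : Fin k => Finset.range (n + 1)).card := by
        refine Finset.card_le_card fun c hc => ?_
        rw [Finset.mem_piAntidiag] at hc
        rw [Fintype.mem_piFinset]
        intro x
        rw [Finset.mem_range, Nat.lt_succ_iff, ← hc.1]
        exact Finset.single_le_sum (f := c) (fun _ _ => Nat.zero_le _) (Finset.mem_univ x)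
    _ = _ := by simp

lemma sum_typeProb {k : ℕ} {P : Fin k → ℝ} (hP : ∑ x, P x = 1) (n : ℕ) :
    ∑ c ∈ Finset.piAntidiag Finset.univ n, typeProb P c = 1 := by
  have := Finset.sum_pow_eq_sum_piAntidiag (Finset.univ : Finset (Fin k)) P n
  rw [hP, one_pow] at this
  exact this.symm

lemma typeProb_nonneg {k : ℕ} {P : Fin k → ℝ} (hP : ∀ x, 0 ≤ P x) (c : Fin k → ℕ) :
    0 ≤ typeProb P c :=
  mul_nonneg (Nat.cast_nonneg _) (Finset.prod_nonneg fun x _ => pow_nonneg (hP x) _)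

lemma typeProb_pos {k : ℕ} {P : Fin k → ℝ} (hP : ∀ x, 0 < P x) (c : Fin k → ℕ) :
    0 < typeProb P c :=
  mul_pos (Nat.cast_pos.2 (Nat.multinomial_pos _ _)) (Finset.prod_pos fun x _ => pow_pos (hP x) _)

lemma sum_typeLaw {k : ℕ} {n : ℕ} (hn : 0 < n) {c : Fin k → ℕ} (hc : ∑ x, c x = n) :
    ∑ x, typeLaw n c x = 1 := by
  simp only [typeLaw]
  rw [← Finset.sum_div, ← Nat.cast_sum, hc, div_self (by positivity)]

lemma typeProb_typeLaw_le_one {k : ℕ} {n : ℕ} (hn : 0 < n) {c : Fin k → ℕ}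
    (hc : ∑ x, c x = n) : typeProb (typeLaw n c) c ≤ 1 := by
  rw [← sum_typeProb (sum_typeLaw hn hc) n]
  refine Finset.single_le_sum (f := fun c' => typeProb (typeLaw n c) c')
    (fun c' _ => typeProb_nonneg (fun x => by unfold typeLaw; positivity) c') ?_
  simp [hc]

lemma typeProb_typeLaw_le {k : ℕ} {n : ℕ} {c c' : Fin k → ℕ}
    (hc : ∑ x, c x = n) (hc' : ∑ x, c' x = n) :
    typeProb (typeLaw n c) c' ≤ typeProb (typeLaw n c) c := by
  have key : ∀ e : Fin k → ℕ, ∑ x, e x = n → typeProb (typeLaw n c) e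
      = ((Nat.multinomial Finset.univ e * ∏ x, c x ^ e x : ℕ) : ℝ) / (n : ℝ) ^ n := by
    intro e he
    simp only [typeProb, typeLaw, div_pow]
    rw [Finset.prod_div_distrib, Finset.prod_pow_eq_pow_sum, he]
    push_cast
    ring
  rw [key c' hc', key c hc]
  refine div_le_div_of_nonneg_right (Nat.cast_le.2 ?_) (by positivity)
  exact multinomial_mul_prod_pow_le (hc.trans hc'.symm)

/-- The total mass `1` is shared by at most `(n+1)^k` types, and `c` is the most likely of them. -/
lemma one_le_typeProb_typeLaw {k : ℕ} {n : ℕ} (hn : 0 < n) {c : Fin k → ℕ}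
    (hc : ∑ x, c x = n) : 1 ≤ ((n : ℝ) + 1) ^ k * typeProb (typeLaw n c) c := by
  refine (sum_typeProb (sum_typeLaw hn hc) n).symm.le.trans ?_
  refine (Finset.sum_le_card_nsmul _ _ _ fun c' hc' => typeProb_typeLaw_le hc ?_).trans ?_
  · simpa using hc'
  · rw [nsmul_eq_mul]
    refine mul_le_mul_of_nonneg_right ?_ (typeProb_nonneg (fun x => by unfold typeLaw; positivity) c)
    exact_mod_cast card_piAntidiag_le k n

/-- The method of types: the divergence governs the probability of a type. -/
lemma typeProb_eq {k : ℕ} {n : ℕ} (hn : 0 < n) {c : Fin k → ℕ} {P : Fin k → ℝ}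
    (hc : ∀ x, 0 < typeLaw n c x) (hP : ∀ x, 0 < P x) :
    typeProb P c = typeProb (typeLaw n c) c * Real.exp (-(n * klDiv (typeLaw n c) P)) := by
  have hn' : (n : ℝ) ≠ 0 := by positivity
  have hexp : Real.exp (-(n * klDiv (typeLaw n c) P)) = ∏ x, (P x / typeLaw n c x) ^ c x := by
    rw [klDiv, Finset.mul_sum, ← Finset.sum_neg_distrib, Real.exp_sum]
    refine Finset.prod_congr rfl fun x _ => ?_
    rw [← Real.exp_log (pow_pos (div_pos (hP x) (hc x)) (c x)), Real.log_pow, ← inv_div,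
      Real.log_inv]
    congr 1
    rw [mul_neg, mul_neg, neg_neg, ← mul_assoc]
    congr 1
    unfold typeLaw
    field_simp
  rw [hexp, typeProb, typeProb, mul_assoc, ← Finset.prod_mul_distrib]
  congr 1
  refine Finset.prod_congr rfl fun x _ => ?_
  rw [← mul_pow, mul_div_cancel₀ _ (hc x).ne']

lemma typeProb_le_exp {k : ℕ} {n : ℕ} (hn : 0 < n) {c : Fin k → ℕ} {P : Fin k → ℝ}
    (hcn : ∑ x, c x = n) (hc : ∀ x, 0 < typeLaw n c x) (hP : ∀ x, 0 < P x) :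
    typeProb P c ≤ Real.exp (-(n * klDiv (typeLaw n c) P)) := by
  rw [typeProb_eq hn hc hP]
  exact mul_le_of_le_one_left (Real.exp_pos _).le (typeProb_typeLaw_le_one hn hcn)

lemma exp_le_mul_typeProb {k : ℕ} {n : ℕ} (hn : 0 < n) {c : Fin k → ℕ} {P : Fin k → ℝ}
    (hcn : ∑ x, c x = n) (hc : ∀ x, 0 < typeLaw n c x) (hP : ∀ x, 0 < P x) :
    Real.exp (-(n * klDiv (typeLaw n c) P)) ≤ ((n : ℝ) + 1) ^ k * typeProb P c := by
  rw [typeProb_eq hn hc hP, ← mul_assoc]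
  exact le_mul_of_one_le_left (Real.exp_pos _).le (one_le_typeProb_typeLaw hn hcn)

/-! ### The tempered posterior -/

/-- On the feasible types the likelihoods of `Q` and of its information projection are
proportional. -/
lemma exists_typeProb_eq_mul {k d : ℕ} {h : Fin k → Fin d → ℝ} {α : Fin d → ℝ}
    {Q P : Fin k → ℝ} (hQ : Q ∈ openSimplex k) (hP : IsInfoProjection h α Q P) (n : ℕ) :
    ∃ M : ℝ, 0 < M ∧ ∀ c ∈ feasibleTypes h α n, typeProb Q c = M * typeProb P c := by
  refine ⟨Real.exp (-(n * klDiv P Q)), Real.exp_pos _, fun c hc => ?_⟩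
  obtain ⟨hcn, hcE⟩ := mem_feasibleTypes.1 hc
  rcases n.eq_zero_or_pos with rfl | hn
  · have h0 : ∀ x, c x = 0 := fun x => by simpa using (Finset.sum_eq_zero_iff.1 hcn) x
    simp [typeProb, h0]
  have hn' : (n : ℝ) ≠ 0 := by positivity
  obtain ⟨h1, h2⟩ := sub_tangent_of_mem_feasibleSet hP.1 hcE
  have h3 := sum_mul_log_infoProjection_eq_zero hQ hP h1 h2
  -- Pythagorean identity: the two sides differ by the first-order condition `h3` in the direction
  -- `typeLaw n c - P`.
  have h4 : klDiv (typeLaw n c) Q = klDiv (typeLaw n c) P + klDiv P Q := by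
    rw [← sub_eq_zero, ← h3, klDiv, klDiv, klDiv, ← Finset.sum_add_distrib,
      ← Finset.sum_sub_distrib]
    refine Finset.sum_congr rfl fun x _ => ?_
    have hcx := (hcE.1.1 x).ne'
    have hPx := (hP.1.1.1 x).ne'
    have hQx := (hQ.1 x).ne'
    rw [Real.log_div hcx hQx, Real.log_div hcx hPx, Real.log_div hPx hQx]
    ring
  rw [typeProb_eq hn hcE.1.1 hQ.1, typeProb_eq hn hcE.1.1 hP.1.1.1, h4, mul_add, neg_add,
    Real.exp_add]
  ring

/-! ### Feasible types near the projection -/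

/-- Feasible types lie at bounded distance from `n P`, for every feasible law `P` with cells at
least `δ`. -/
lemma exists_feasibleType_near {k d : ℕ} {h : Fin k → Fin d → ℝ} (hL : IsLatticeFeature h) :
    ∃ B : ℝ, 0 ≤ B ∧ ∀ (α : Fin d → ℝ) (P : Fin k → ℝ) (δ : ℝ) (n : ℕ), P ∈ feasibleSet h α →
      (∀ x, δ ≤ P x) → B < n * δ → (feasibleTypes h α n).Nonempty →
      ∃ c ∈ feasibleTypes h α n, ∀ x, |typeLaw n c x - P x| ≤ B / n := by
  -- A basis `b` of the tangent space made of integer vectors. The bound `B` is the sum of their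
  -- `ℓ¹` norms: rounding down one coefficient moves a cell by at most the absolute value of that
  -- coordinate.
  obtain ⟨b, hbS, hspan, hli⟩ := exists_linearIndependent ℝ
    {v : EuclideanSpace ℝ (Fin k) | v ∈ tangentSpace h ∧ ∀ x, ∃ z : ℤ, v x = z}
  rw [hL] at hspan
  have : Fintype b := hli.setFinite.fintype
  refine ⟨∑ w : b, ∑ x, |(w : EuclideanSpace ℝ (Fin k)) x|,
    Finset.sum_nonneg fun _ _ => Finset.sum_nonneg fun _ _ => abs_nonneg _, ?_⟩
  rintro α P δ n hP hδ hn ⟨c, hc⟩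
  obtain ⟨hcn, hcE⟩ := mem_feasibleTypes.1 hc
  have hn0 : 0 < n := by
    rcases n.eq_zero_or_pos with rfl | hn0
    · exact absurd hn (by
        rw [Nat.cast_zero, zero_mul, not_lt]
        exact Finset.sum_nonneg fun _ _ => Finset.sum_nonneg fun _ _ => abs_nonneg _)
    · exact hn0
  have hn' : (n : ℝ) ≠ 0 := by positivity
  have hnpos : (0 : ℝ) < n := by positivity
  obtain ⟨h1, h2⟩ := sub_tangent_of_mem_feasibleSet hcE hP
  have hmem : (WithLp.toLp 2 fun x => (n : ℝ) * (P x - typeLaw n c x)) ∈ tangentSpace h := by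
    refine ⟨?_, fun j => ?_⟩
    · simp only [← Finset.mul_sum, h1, mul_zero]
    · simp only [mul_assoc, ← Finset.mul_sum, h2 j, mul_zero]
  rw [← hspan, ← Subtype.range_coe (s := b), Submodule.mem_span_range_iff_exists_fun] at hmem
  obtain ⟨a, ha⟩ := hmem
  have ha' : ∀ x, ∑ w : b, a w * (w : EuclideanSpace ℝ (Fin k)) x = n * P x - c x := by
    intro x
    have := congrArg (fun v : EuclideanSpace ℝ (Fin k) => v x) ha
    simp only [WithLp.ofLp_sum, Finset.sum_apply, PiLp.smul_apply, smul_eq_mul] at this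
    rw [this, typeLaw]
    field_simp
  choose z hz using fun w : b => (hbS w.2).2
  have hdist : ∀ x, |c x + ∑ w : b, (⌊a w⌋ : ℝ) * z w x - n * P x|
      ≤ ∑ w : b, ∑ x, |(w : EuclideanSpace ℝ (Fin k)) x| := by
    intro x
    have : c x + ∑ w : b, (⌊a w⌋ : ℝ) * z w x - n * P x
        = ∑ w : b, (⌊a w⌋ - a w) * (w : EuclideanSpace ℝ (Fin k)) x := by
      simp only [sub_mul, Finset.sum_sub_distrib, ha', ← hz]
      ring
    rw [this]
    refine (Finset.abs_sum_le_sum_abs _ _).trans (Finset.sum_le_sum fun w _ => ?_)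
    rw [abs_mul]
    refine (mul_le_of_le_one_left (abs_nonneg _) ?_).trans (Finset.single_le_sum
      (f := fun x => |(w : EuclideanSpace ℝ (Fin k)) x|) (fun _ _ => abs_nonneg _)
      (Finset.mem_univ x))
    rw [abs_le]
    constructor <;> linarith [Int.floor_le (a w), Int.lt_floor_add_one (a w)]
  -- The rounded counts stay positive because `n P x ≥ n δ > B`.
  have hpos : ∀ x, (0 : ℝ) < ((c x + ∑ w : b, ⌊a w⌋ * z w x : ℤ) : ℝ) := by
    intro x
    push_cast
    have h3 := (abs_le.1 (hdist x)).1
    have h4 := mul_le_mul_of_nonneg_left (hδ x) hnpos.le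
    linarith
  choose c' hc' using fun x => Int.eq_ofNat_of_zero_le (Int.cast_pos.1 (hpos x)).le
  have hcr : ∀ x, (c' x : ℝ) = c x + ∑ w : b, (⌊a w⌋ : ℝ) * z w x := by
    intro x
    have := congrArg (Int.cast (R := ℝ)) (hc' x)
    push_cast at this
    exact this.symm
  have hlaw : ∀ x, typeLaw n c' x = typeLaw n c x
      + ∑ w : b, (⌊a w⌋ : ℝ) * (w : EuclideanSpace ℝ (Fin k)) x / n := by
    intro x
    rw [typeLaw, typeLaw, hcr, add_div, Finset.sum_div]
    simp only [hz]
  -- Steps along `b` preserve every linear functional that vanishes on `b`; used for the total mass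
  -- and for each moment constraint.
  have hsum : ∀ g : Fin k → ℝ,
      (∀ w : b, ∑ x, (w : EuclideanSpace ℝ (Fin k)) x * g x = 0) →
      ∑ x, typeLaw n c' x * g x = ∑ x, typeLaw n c x * g x := by
    intro g hg
    simp only [hlaw, add_mul, Finset.sum_add_distrib, Finset.sum_mul]
    rw [Finset.sum_comm, add_eq_left]
    refine Finset.sum_eq_zero fun w _ => ?_
    rw [← mul_zero ((⌊a w⌋ : ℝ) / n), ← hg w, Finset.mul_sum]
    exact Finset.sum_congr rfl fun x _ => by ring
  have hone : ∑ x, typeLaw n c' x = 1 := by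
    rw [← hcE.1.2]
    simpa using hsum (fun _ => 1) fun w => by simpa using (hbS w.2).1.1
  refine ⟨c', mem_feasibleTypes.2 ⟨?_, ⟨fun x => ?_, hone⟩, fun j => ?_⟩, fun x => ?_⟩
  · simp only [typeLaw] at hone
    rw [← Finset.sum_div, div_eq_one_iff_eq hn', ← Nat.cast_sum] at hone
    exact_mod_cast hone
  · have := hpos x
    rw [hc' x] at this
    exact div_pos (by exact_mod_cast this) hnpos
  · rw [← hcE.2 j]
    exact hsum (fun x => h x j) fun w => (hbS w.2).1.2 j
  · rw [le_div_iff₀ hnpos, ← abs_of_pos hnpos, ← abs_mul]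
    refine le_of_eq_of_le ?_ (hdist x)
    rw [← hcr, typeLaw]
    congr 1
    field_simp

/-! ### Sampling with and without replacement -/

lemma symbolCount_cons {k m : ℕ} (a : Fin k) (y : Fin m → Fin k) (x : Fin k) :
    symbolCount (Fin.cons a y : Fin (m + 1) → Fin k) x
      = symbolCount y x + if a = x then 1 else 0 := by
  simp only [symbolCount, Finset.card_filter, Fin.sum_univ_succ, Fin.cons_zero, Fin.cons_succ]
  rw [add_comm]

lemma sum_fin_succ_fun {k m : ℕ} (f : (Fin (m + 1) → Fin k) → ℝ) :
    ∑ y, f y = ∑ y : Fin m → Fin k, ∑ a, f (Fin.cons a y) := by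
  rw [← (Fin.consEquiv fun _ : Fin (m + 1) => Fin k).sum_comp, Fintype.sum_prod_type,
    Finset.sum_comm]
  rfl

lemma sum_symbolCount {k m : ℕ} (y : Fin m → Fin k) : ∑ x, symbolCount y x = m := by
  simp only [symbolCount]
  rw [← Finset.card_eq_sum_card_fiberwise (fun _ _ => Finset.mem_coe.2 (Finset.mem_univ _))]
  simp

lemma sum_prod_descFactorial {k n : ℕ} {c : Fin k → ℕ} (hc : ∑ x, c x = n) (m : ℕ) :
    ∑ y : Fin m → Fin k, ∏ x, ((c x).descFactorial (symbolCount y x) : ℝ)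
      = (n.descFactorial m : ℝ) := by
  induction m with
  | zero => simp [symbolCount]
  | succ m ih =>
    rw [sum_fin_succ_fun, Nat.descFactorial_succ, Nat.cast_mul, ← ih, Finset.mul_sum]
    refine Finset.sum_congr rfl fun y _ => ?_
    have h1 : ∀ a, ∏ x, ((c x).descFactorial
          (symbolCount (Fin.cons a y : Fin (m + 1) → Fin k) x) : ℝ)
        = ((c a - symbolCount y a : ℕ) : ℝ) * ∏ x, ((c x).descFactorial (symbolCount y x) : ℝ) := by
      intro a
      rw [← Finset.mul_prod_erase _ _ (Finset.mem_univ a),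
        ← Finset.mul_prod_erase _ (fun x => ((c x).descFactorial (symbolCount y x) : ℝ))
          (Finset.mem_univ a), ← mul_assoc, symbolCount_cons, if_pos rfl, Nat.descFactorial_succ,
        Nat.cast_mul]
      congr 1
      refine Finset.prod_congr rfl fun x hx => ?_
      rw [symbolCount_cons, if_neg (Finset.ne_of_mem_erase hx).symm, add_zero]
    simp only [h1]
    rw [← Finset.sum_mul]
    -- The truncated differences `c a - symbolCount y a` add up to `n - m` when no symbol is
    -- overdrawn; otherwise the product of falling factorials vanishes.
    by_cases h2 : ∀ x, symbolCount y x ≤ c x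
    · congr 1
      rw [← Nat.cast_sum]
      congr 1
      zify
      have h3 := sum_symbolCount y
      have h4 : m ≤ n := by
        rw [← h3, ← hc]
        exact Finset.sum_le_sum fun x _ => h2 x
      rw [Nat.cast_sub h4]
      simp only [Nat.cast_sub (h2 _)]
      rw [Finset.sum_sub_distrib, ← Nat.cast_sum, ← Nat.cast_sum, hc, h3]
    · push Not at h2
      obtain ⟨x, hx⟩ := h2
      rw [Finset.prod_eq_zero (Finset.mem_univ x)
        (Nat.cast_eq_zero.2 (Nat.descFactorial_eq_zero_iff_lt.2 hx)), mul_zero, mul_zero]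

lemma sum_hypergeometricLaw {k n m : ℕ} {c : Fin k → ℕ} (hc : ∑ x, c x = n) (hm : m ≤ n) :
    ∑ y : Fin m → Fin k, hypergeometricLaw n m c y = 1 := by
  simp only [hypergeometricLaw]
  rw [← Finset.sum_div, sum_prod_descFactorial hc, div_self]
  exact Nat.cast_ne_zero.2 (Nat.descFactorial_pos.2 hm).ne'

lemma hypergeometricLaw_nonneg {k : ℕ} (n m : ℕ) (c : Fin k → ℕ) (y : Fin m → Fin k) :
    0 ≤ hypergeometricLaw n m c y :=
  div_nonneg (Finset.prod_nonneg fun _ _ => Nat.cast_nonneg _) (Nat.cast_nonneg _)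

lemma productLaw_nonneg {k : ℕ} {P : Fin k → ℝ} (hP : ∀ x, 0 ≤ P x) (m : ℕ)
    (y : Fin m → Fin k) : 0 ≤ productLaw P m y :=
  Finset.prod_nonneg fun _ _ => hP _

lemma productLaw_cons {k m : ℕ} (P : Fin k → ℝ) (a : Fin k) (y : Fin m → Fin k) :
    productLaw P (m + 1) (Fin.cons a y) = P a * productLaw P m y := by
  simp [productLaw, Fin.prod_univ_succ]

lemma sum_productLaw {k : ℕ} {P : Fin k → ℝ} (hP : ∑ x, P x = 1) (m : ℕ) :
    ∑ y, productLaw P m y = 1 := by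
  induction m with
  | zero => simp [productLaw]
  | succ m ih => simp only [sum_fin_succ_fun, productLaw_cons, ← Finset.sum_mul, hP, one_mul, ih]

lemma productLaw_eq_prod_pow {k m : ℕ} (P : Fin k → ℝ) (y : Fin m → Fin k) :
    productLaw P m y = ∏ x, P x ^ symbolCount y x := by
  rw [productLaw, ← Finset.prod_fiberwise_of_maps_to (g := y) (t := Finset.univ)
    (fun _ _ => Finset.mem_univ _)]
  refine Finset.prod_congr rfl fun x _ => ?_
  rw [symbolCount, ← Finset.prod_const]
  exact Finset.prod_congr rfl fun i hi => by rw [(Finset.mem_filter.1 hi).2]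

/-- Hybrid argument: replacing `P` by `Q` in one coordinate costs one `ℓ¹` distance. -/
lemma sum_abs_productLaw_sub_le {k : ℕ} {P Q : Fin k → ℝ} (hP : P ∈ openSimplex k)
    (hQ : Q ∈ openSimplex k) (m : ℕ) :
    ∑ y, |productLaw P m y - productLaw Q m y| ≤ m * ∑ x, |P x - Q x| := by
  induction m with
  | zero => simp [productLaw]
  | succ m ih =>
    calc ∑ y, |productLaw P (m + 1) y - productLaw Q (m + 1) y|
        ≤ ∑ y : Fin m → Fin k, ∑ a, (P a * |productLaw P m y - productLaw Q m y|
            + |P a - Q a| * productLaw Q m y) := by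
          rw [sum_fin_succ_fun]
          refine Finset.sum_le_sum fun y _ => Finset.sum_le_sum fun a _ => ?_
          rw [productLaw_cons, productLaw_cons,
            show P a * productLaw P m y - Q a * productLaw Q m y
              = P a * (productLaw P m y - productLaw Q m y) + (P a - Q a) * productLaw Q m y by ring]
          refine (abs_add_le _ _).trans_eq ?_
          rw [abs_mul, abs_mul, abs_of_pos (hP.1 a),
            abs_of_nonneg (productLaw_nonneg (fun x => (hQ.1 x).le) m y)]
      _ = ∑ y, |productLaw P m y - productLaw Q m y| + ∑ x, |P x - Q x| := by
          simp only [Finset.sum_add_distrib, ← Finset.sum_mul, ← Finset.mul_sum, hP.2, one_mul,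
            sum_productLaw hQ.2, mul_one]
      _ ≤ _ := by
          push_cast
          linarith

/-- A law dominated by `ν / ρ` is within `1 - ρ` of `ν` in total variation. -/
lemma sum_abs_sub_le_of_mul_le {S : Type*} [Fintype S] {μ ν : S → ℝ} {ρ : ℝ}
    (hμ : ∑ s, μ s = 1) (hν : ∑ s, ν s = 1) (hμ0 : ∀ s, 0 ≤ μ s) (hρ : ρ ≤ 1)
    (hle : ∀ s, ρ * μ s ≤ ν s) : ∑ s, |μ s - ν s| ≤ 2 * (1 - ρ) := by
  -- Pointwise `μ - ν ≤ (1 - ρ) μ` with nonnegative right side; the subtracted `μ - ν` sums to zero.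
  calc ∑ s, |μ s - ν s| ≤ ∑ s, (2 * ((1 - ρ) * μ s) - (μ s - ν s)) := by
        refine Finset.sum_le_sum fun s _ => ?_
        have h1 := mul_nonneg (sub_nonneg.2 hρ) (hμ0 s)
        rw [abs_le]
        constructor <;> linarith [hle s]
    _ = _ := by
        rw [Finset.sum_sub_distrib, Finset.sum_sub_distrib, hμ, hν, ← Finset.mul_sum,
          ← Finset.mul_sum, hμ]
        ring

/-- The falling factorial is at least `(n - m)^m`, and Bernoulli's inequality bounds `(1 - m/n)^m`
below. -/
lemma one_sub_sq_div_le_descFactorial_div {n m : ℕ} (hn : 0 < n) (hm : m ≤ n) :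
    1 - (m : ℝ) ^ 2 / n ≤ (n.descFactorial m : ℝ) / (n : ℝ) ^ m := by
  have hn' : (0 : ℝ) < n := by positivity
  have hmn : (m : ℝ) / n ≤ 1 := (div_le_one hn').2 (by exact_mod_cast hm)
  have h1 := one_add_mul_le_pow (a := -((m : ℝ) / n)) (by linarith) m
  calc 1 - (m : ℝ) ^ 2 / n = 1 + m * -((m : ℝ) / n) := by ring
    _ ≤ (1 + -((m : ℝ) / n)) ^ m := h1
    _ = ((n - m : ℕ) : ℝ) ^ m / (n : ℝ) ^ m := by
        rw [← div_pow, Nat.cast_sub hm, sub_div, div_self hn'.ne', sub_eq_add_neg]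
    _ ≤ _ := by
        gcongr
        exact_mod_cast (Nat.pow_le_pow_left (by omega) m).trans (Nat.pow_sub_le_descFactorial n m)

/-- Sampling without replacement is close to sampling with replacement. -/
lemma sum_abs_hypergeometricLaw_sub_le {k n m : ℕ} (hn : 0 < n) {c : Fin k → ℕ}
    (hc : ∑ x, c x = n) (hm : m ≤ n) :
    ∑ y, |hypergeometricLaw n m c y - productLaw (typeLaw n c) m y| ≤ 2 * ((m : ℝ) ^ 2 / n) := by
  have hn' : (0 : ℝ) < n := by positivity
  have hd : (0 : ℝ) < n.descFactorial m := by exact_mod_cast Nat.descFactorial_pos.2 hm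
  have h1 := sum_abs_sub_le_of_mul_le (ρ := (n.descFactorial m : ℝ) / (n : ℝ) ^ m)
    (sum_hypergeometricLaw hc hm) (sum_productLaw (sum_typeLaw hn hc) m)
    (hypergeometricLaw_nonneg n m c)
    ((div_le_one (by positivity)).2 (by exact_mod_cast Nat.descFactorial_le_pow n m)) ?_
  · linarith [one_sub_sq_div_le_descFactorial_div hn hm]
  · intro y
    rw [productLaw_eq_prod_pow, hypergeometricLaw, div_mul_div_comm, mul_comm,
      mul_div_mul_right _ _ hd.ne']
    simp only [typeLaw, div_pow]
    rw [Finset.prod_div_distrib, Finset.prod_pow_eq_pow_sum, sum_symbolCount]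
    gcongr with x
    exact_mod_cast Nat.descFactorial_le_pow _ _

/-! ### Concentration of the tempered posterior -/

lemma temperedPosterior_nonneg {k d : ℕ} (h : Fin k → Fin d → ℝ) (α : Fin d → ℝ)
    {Q : Fin k → ℝ} (hQ : ∀ x, 0 < Q x) (T : ℝ) (n : ℕ) (c : Fin k → ℕ) :
    0 ≤ temperedPosterior h α Q T n c :=
  div_nonneg (Real.rpow_nonneg (typeProb_pos hQ c).le _)
    (Finset.sum_nonneg fun c' _ => Real.rpow_nonneg (typeProb_pos hQ c').le _)

lemma sum_temperedPosterior {k d : ℕ} {h : Fin k → Fin d → ℝ} {α : Fin d → ℝ}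
    {Q : Fin k → ℝ} (hQ : ∀ x, 0 < Q x) (T : ℝ) {n : ℕ} (hE : (feasibleTypes h α n).Nonempty) :
    ∑ c ∈ feasibleTypes h α n, temperedPosterior h α Q T n c = 1 := by
  simp only [temperedPosterior]
  rw [← Finset.sum_div, div_self]
  exact (Finset.sum_pos (fun c _ => Real.rpow_pos_of_pos (typeProb_pos hQ c) _) hE).ne'

/-- Only the term of `c₀` is kept in the normaliser, and the proportionality factor between `Q` and
`P` likelihoods cancels. -/
lemma temperedPosterior_le_rpow {k d : ℕ} {h : Fin k → Fin d → ℝ} {α : Fin d → ℝ}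
    {Q P : Fin k → ℝ} (hQ : Q ∈ openSimplex k) (hP : IsInfoProjection h α Q P) (T : ℝ) {n : ℕ}
    {c c₀ : Fin k → ℕ} (hc : c ∈ feasibleTypes h α n) (hc₀ : c₀ ∈ feasibleTypes h α n) :
    temperedPosterior h α Q T n c ≤ (typeProb P c / typeProb P c₀) ^ (1 / T) := by
  obtain ⟨M, hM, hMc⟩ := exists_typeProb_eq_mul hQ hP n
  have hpos := fun e => typeProb_pos hQ.1 e
  rw [temperedPosterior, ← mul_div_mul_left (typeProb P c) (typeProb P c₀) hM.ne', ← hMc c hc,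
    ← hMc c₀ hc₀, Real.div_rpow (hpos c).le (hpos c₀).le]
  exact div_le_div_of_nonneg_left (Real.rpow_nonneg (hpos c).le _)
    (Real.rpow_pos_of_pos (hpos c₀) _)
    (Finset.single_le_sum (f := fun e => typeProb Q e ^ (1 / T))
      (fun e _ => Real.rpow_nonneg (hpos e).le _) hc₀)

lemma add_one_pow_le_exp {n : ℕ} (hn : 3 ≤ n) (k : ℕ) :
    ((n : ℝ) + 1) ^ k ≤ Real.exp (2 * k * Real.log n) := by
  have h3 : (3 : ℝ) ≤ n := by exact_mod_cast hn
  have h1 : (n : ℝ) + 1 ≤ Real.exp (2 * Real.log n) := by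
    rw [mul_comm, Real.exp_mul, Real.exp_log (by linarith)]
    norm_cast
    nlinarith
  calc ((n : ℝ) + 1) ^ k ≤ Real.exp (2 * Real.log n) ^ k := pow_le_pow_left₀ (by linarith) h1 k
    _ = _ := by rw [← Real.exp_nat_mul]; ring_nf

lemma one_le_log_of_three_le {n : ℕ} (hn : 3 ≤ n) : 1 ≤ Real.log n := by
  have h3 : (3 : ℝ) ≤ n := by exact_mod_cast hn
  rw [Real.le_log_iff_exp_le (by linarith)]
  linarith [Real.exp_one_lt_d9]

/-- The budget `(2k+1)(1+T) log n` splits in two. One share `(2k+1) log n` pays for the likelihood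
of `c₀`, which is at least `e^{-1} n^{-2k} ≥ n^{-(2k+1)}`. The share `(2k+1) T log n` becomes
`(2k+1) log n` after taking the power `1/T`, enough to beat the number of types with a factor `1/n`
to spare. -/
lemma temperedPosterior_le_exp {k d : ℕ} {h : Fin k → Fin d → ℝ} {α : Fin d → ℝ}
    {Q P : Fin k → ℝ} (hQ : Q ∈ openSimplex k) (hP : IsInfoProjection h α Q P) {T : ℝ}
    (hT : 0 < T) {n : ℕ} (hn : 3 ≤ n) {c c₀ : Fin k → ℕ} (hc : c ∈ feasibleTypes h α n)
    (hc₀ : c₀ ∈ feasibleTypes h α n) (hnear : n * klDiv (typeLaw n c₀) P ≤ 1)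
    (hfar : (2 * k + 1) * (1 + T) * Real.log n ≤ n * klDiv (typeLaw n c) P) :
    temperedPosterior h α Q T n c ≤ Real.exp (-((2 * k + 1) * Real.log n)) := by
  obtain ⟨hcn, hcE⟩ := mem_feasibleTypes.1 hc
  obtain ⟨hc₀n, hc₀E⟩ := mem_feasibleTypes.1 hc₀
  have hn0 : 0 < n := by omega
  have hPpos := hP.1.1.1
  have hlog := one_le_log_of_three_le hn
  refine (temperedPosterior_le_rpow hQ hP T hc hc₀).trans ?_
  have h1 : typeProb P c ≤ Real.exp (-((2 * k + 1) * (1 + T) * Real.log n)) :=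
    (typeProb_le_exp hn0 hcn hcE.1.1 hPpos).trans (Real.exp_le_exp.2 (neg_le_neg hfar))
  have h2 : Real.exp (-((2 * k + 1) * Real.log n)) ≤ typeProb P c₀ := by
    have h3 : Real.exp (-1) ≤ Real.exp (2 * k * Real.log n) * typeProb P c₀ :=
      (Real.exp_le_exp.2 (neg_le_neg hnear)).trans <|
        (exp_le_mul_typeProb hn0 hc₀n hc₀E.1.1 hPpos).trans
        (mul_le_mul_of_nonneg_right (add_one_pow_le_exp hn k) (typeProb_pos hPpos c₀).le)
    rw [mul_comm, ← div_le_iff₀ (Real.exp_pos _), ← Real.exp_sub] at h3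
    exact (Real.exp_le_exp.2 (by linarith)).trans h3
  have h4 : typeProb P c / typeProb P c₀ ≤ Real.exp (-((2 * k + 1) * Real.log n) * T) := by
    rw [div_le_iff₀ (typeProb_pos hPpos c₀)]
    calc typeProb P c ≤ Real.exp (-((2 * k + 1) * Real.log n) * T) *
          Real.exp (-((2 * k + 1) * Real.log n)) := by
          rw [← Real.exp_add]
          refine h1.trans_eq ?_
          ring_nf
      _ ≤ _ := mul_le_mul_of_nonneg_left h2 (Real.exp_pos _).le
  calc (typeProb P c / typeProb P c₀) ^ (1 / T)
      ≤ Real.exp (-((2 * k + 1) * Real.log n) * T) ^ (1 / T) :=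
        Real.rpow_le_rpow (div_nonneg (typeProb_pos hPpos c).le (typeProb_pos hPpos c₀).le) h4
          (by positivity)
    _ = _ := by
        rw [← Real.exp_mul, mul_assoc, mul_one_div_cancel hT.ne', mul_one]

/-- Types far from the information projection have large divergence, uniformly in the curvature
on the scale of temperatures comparable to it. -/
lemma le_mul_klDiv_of_far {k d : ℕ} {h : Fin k → Fin d → ℝ} (hV : tangentSpace h ≠ ⊥)
    {α : Fin d → ℝ} {P : Fin k → ℝ} (hP : P ∈ feasibleSet h α) {δ : ℝ} (hδ : 0 < δ)
    (hPδ : ∀ x, δ ≤ P x) {K T : ℝ} (hK : 0 ≤ K) (hTK : T ≤ K * lambdaMin h P) {n : ℕ}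
    (hn : 3 ≤ n) (hnδ : (2 * k + 1) * (1 + K / δ) * Real.log n ≤ n * (δ ^ 2 / 4))
    {c : Fin k → ℕ} (hc : c ∈ feasibleTypes h α n)
    (hfar : 6 * (2 * k + 1) * (1 + K) * (Real.log n / n) ≤ ∑ x, (typeLaw n c x - P x) ^ 2) :
    (2 * k + 1) * (1 + T) * Real.log n ≤ n * klDiv (typeLaw n c) P := by
  obtain ⟨hcn, hcE⟩ := mem_feasibleTypes.1 hc
  have hn0 : (0 : ℝ) < n := by exact_mod_cast (by omega : 0 < n)
  have hlog := one_le_log_of_three_le hn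
  have hlam := one_le_lambdaMin hV hP.1
  by_cases hnear : ∀ x, typeLaw n c x ≤ 2 * P x
  · obtain ⟨h1, h2⟩ := sub_tangent_of_mem_feasibleSet hP hcE
    have h3 := lambdaMin_mul_sum_sq_le hV hP.1 h1 h2
    have h4 := sum_sq_div_le_klDiv_of_le hcE.1 hP.1 hnear
    -- This is where the curvature cancels: the temperature is at most `K λ_min` and the divergence
    -- grows at least like `λ_min`.
    have h5 : 1 + T ≤ lambdaMin h P * (1 + K) := by nlinarith
    calc (2 * k + 1) * (1 + T) * Real.log n
        ≤ (2 * k + 1) * (lambdaMin h P * (1 + K)) * Real.log n := by gcongr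
      _ = n * (lambdaMin h P * (6 * (2 * k + 1) * (1 + K) * (Real.log n / n)) / 6) := by
          field_simp
      _ ≤ n * ((lambdaMin h P * ∑ x, (typeLaw n c x - P x) ^ 2) / 6) := by gcongr
      _ ≤ n * klDiv (typeLaw n c) P := by
          refine mul_le_mul_of_nonneg_left ?_ hn0.le
          linarith
  -- A cell is more than doubled, so it is off by at least `δ` and the divergence is at least
  -- `δ²/4`; the sample size beats the temperature, now bounded by `K/δ`.
  · push Not at hnear
    obtain ⟨x, hx⟩ := hnear
    have h1 := sq_sub_div_le_klDiv hcE.1 hP.1 x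
    have h2 : δ ^ 2 ≤ (typeLaw n c x - P x) ^ 2 :=
      pow_le_pow_left₀ hδ.le (by linarith [hPδ x]) 2
    have h3 : T ≤ K / δ := by
      refine hTK.trans ?_
      rw [div_eq_mul_one_div]
      exact mul_le_mul_of_nonneg_left (lambdaMin_le_one_div hV hP.1 hδ hPδ) hK
    calc (2 * k + 1) * (1 + T) * Real.log n ≤ (2 * k + 1) * (1 + K / δ) * Real.log n := by gcongr
      _ ≤ n * (δ ^ 2 / 4) := hnδ
      _ ≤ n * klDiv (typeLaw n c) P := mul_le_mul_of_nonneg_left (by linarith) hn0.le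

lemma sum_abs_sub_le_two {S : Type*} [Fintype S] {μ ν : S → ℝ} (hμ0 : ∀ s, 0 ≤ μ s)
    (hν0 : ∀ s, 0 ≤ ν s) (hμ : ∑ s, μ s = 1) (hν : ∑ s, ν s = 1) :
    ∑ s, |μ s - ν s| ≤ 2 := by
  calc ∑ s, |μ s - ν s| ≤ ∑ s, (μ s + ν s) := Finset.sum_le_sum fun s _ => by
        rw [abs_le]
        constructor <;> linarith [hμ0 s, hν0 s]
    _ = 2 := by rw [Finset.sum_add_distrib, hμ, hν]; norm_num

/-- The tempered posterior concentrates around the information projection. -/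
lemma sum_temperedPosterior_mul_dist_le {k d : ℕ} {h : Fin k → Fin d → ℝ}
    (hV : tangentSpace h ≠ ⊥) {α : Fin d → ℝ} {Q P : Fin k → ℝ} {δ : ℝ} (hδ : 0 < δ)
    (hmod : IsModel h δ Q α P) {K T : ℝ} (hK : 0 ≤ K) (hT : 0 < T)
    (hTK : T ≤ K * lambdaMin h P) {n : ℕ} (hn : 3 ≤ n)
    (hnδ : (2 * k + 1) * (1 + K / δ) * Real.log n ≤ n * (δ ^ 2 / 4)) {c₀ : Fin k → ℕ}
    (hc₀ : c₀ ∈ feasibleTypes h α n) (hnear : n * klDiv (typeLaw n c₀) P ≤ 1) :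
    ∑ c ∈ feasibleTypes h α n, temperedPosterior h α Q T n c * ∑ x, |typeLaw n c x - P x|
      ≤ k * √(6 * (2 * k + 1) * (1 + K)) * √(Real.log n / n) + 2 / n := by
  obtain ⟨hQ, hP, hPδ⟩ := hmod
  have hn0 : (0 : ℝ) < n := by exact_mod_cast (by omega : 0 < n)
  have hterm : ∀ c ∈ feasibleTypes h α n,
      temperedPosterior h α Q T n c * ∑ x, |typeLaw n c x - P x|
      ≤ temperedPosterior h α Q T n c *
          (k * √(6 * (2 * k + 1) * (1 + K)) * √(Real.log n / n))
        + Real.exp (-((2 * k + 1) * Real.log n)) * 2 := by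
    intro c hc
    have hπ := temperedPosterior_nonneg h α hQ.1 T n c
    obtain ⟨hcn, hcE⟩ := mem_feasibleTypes.1 hc
    rcases le_total (6 * (2 * k + 1) * (1 + K) * (Real.log n / n))
      (∑ x, (typeLaw n c x - P x) ^ 2) with hfar | hclose
    · have h1 := temperedPosterior_le_exp hQ hP hT hn hc hc₀ hnear
        (le_mul_klDiv_of_far hV hP.1 hδ hPδ hK hTK hn hnδ hc hfar)
      have h2 := sum_abs_sub_le_two (fun x => (hcE.1.1 x).le) (fun x => (hP.1.1.1 x).le)
        hcE.1.2 hP.1.1.2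
      refine le_add_of_nonneg_of_le (by positivity) ?_
      exact mul_le_mul h1 h2 (Finset.sum_nonneg fun _ _ => abs_nonneg _) (Real.exp_pos _).le
    · refine le_add_of_le_of_nonneg (mul_le_mul_of_nonneg_left ?_ hπ) (by positivity)
      rw [mul_assoc, ← Real.sqrt_mul (by positivity)]
      calc ∑ x, |typeLaw n c x - P x|
          ≤ ∑ _x : Fin k, √(6 * (2 * k + 1) * (1 + K) * (Real.log n / n)) := by
            refine Finset.sum_le_sum fun x _ => Real.abs_le_sqrt (le_trans ?_ hclose)
            exact Finset.single_le_sum (f := fun x => (typeLaw n c x - P x) ^ 2)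
              (fun _ _ => sq_nonneg _) (Finset.mem_univ x)
        _ = _ := by simp
  refine (Finset.sum_le_sum hterm).trans ?_
  rw [Finset.sum_add_distrib, ← Finset.sum_mul, sum_temperedPosterior hQ.1 T ⟨c₀, hc₀⟩, one_mul,
    Finset.sum_const, nsmul_eq_mul]
  refine add_le_add le_rfl ?_
  have hcard : ((feasibleTypes h α n).card : ℝ) ≤ Real.exp (2 * k * Real.log n) := by
    refine le_trans ?_ (add_one_pow_le_exp hn k)
    have hsub : feasibleTypes h α n ⊆ Finset.piAntidiag Finset.univ n := fun c hc => by
      simpa using (mem_feasibleTypes.1 hc).1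
    exact_mod_cast (Finset.card_le_card hsub).trans (card_piAntidiag_le k n)
  calc ((feasibleTypes h α n).card : ℝ) * (Real.exp (-((2 * k + 1) * Real.log n)) * 2)
      ≤ Real.exp (2 * k * Real.log n) * (Real.exp (-((2 * k + 1) * Real.log n)) * 2) := by
        gcongr
    _ = Real.exp (-Real.log n) * 2 := by
        rw [← mul_assoc, ← Real.exp_add]
        ring_nf
    _ = 2 / n := by rw [Real.exp_neg, Real.exp_log hn0]; ring

/-! ### Collapse of the tempered predictive laws -/

lemma temperedPredictive_nonneg {k d : ℕ} (h : Fin k → Fin d → ℝ) (α : Fin d → ℝ)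
    {Q : Fin k → ℝ} (hQ : ∀ x, 0 < Q x) (T : ℝ) (n m : ℕ) (y : Fin m → Fin k) :
    0 ≤ temperedPredictive h α Q T n m y :=
  Finset.sum_nonneg fun c _ =>
    mul_nonneg (hypergeometricLaw_nonneg n m c y) (temperedPosterior_nonneg h α hQ T n c)

lemma sum_temperedPredictive {k d : ℕ} {h : Fin k → Fin d → ℝ} {α : Fin d → ℝ}
    {Q : Fin k → ℝ} (hQ : ∀ x, 0 < Q x) (T : ℝ) {n m : ℕ} (hm : m ≤ n)
    (hE : (feasibleTypes h α n).Nonempty) :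
    ∑ y, temperedPredictive h α Q T n m y = 1 := by
  simp only [temperedPredictive]
  rw [Finset.sum_comm, ← sum_temperedPosterior hQ T hE]
  refine Finset.sum_congr rfl fun c hc => ?_
  rw [← Finset.sum_mul, sum_hypergeometricLaw (mem_feasibleTypes.1 hc).1 hm, one_mul]

/-- By convexity it suffices to treat each type: first replace sampling without replacement by
i.i.d. draws from the type, then the type by `P`. -/
lemma sum_abs_temperedPredictive_sub_le {k d : ℕ} {h : Fin k → Fin d → ℝ} {α : Fin d → ℝ}
    {Q P : Fin k → ℝ} (hQ : ∀ x, 0 < Q x) (hP : P ∈ openSimplex k) (T : ℝ) {n m : ℕ}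
    (hn : 0 < n) (hm : m ≤ n) (hE : (feasibleTypes h α n).Nonempty) :
    ∑ y, |temperedPredictive h α Q T n m y - productLaw P m y|
      ≤ 2 * ((m : ℝ) ^ 2 / n) + m * ∑ c ∈ feasibleTypes h α n,
          temperedPosterior h α Q T n c * ∑ x, |typeLaw n c x - P x| := by
  have hone := sum_temperedPosterior (h := h) (α := α) hQ T hE
  calc ∑ y, |temperedPredictive h α Q T n m y - productLaw P m y|
      ≤ ∑ y, ∑ c ∈ feasibleTypes h α n,
          temperedPosterior h α Q T n c * |hypergeometricLaw n m c y - productLaw P m y| := by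
        refine Finset.sum_le_sum fun y _ => ?_
        have : temperedPredictive h α Q T n m y - productLaw P m y
            = ∑ c ∈ feasibleTypes h α n, temperedPosterior h α Q T n c *
              (hypergeometricLaw n m c y - productLaw P m y) := by
          simp only [mul_sub, Finset.sum_sub_distrib, ← Finset.sum_mul, hone, one_mul,
            temperedPredictive]
          simp only [mul_comm]
        rw [this]
        refine (Finset.abs_sum_le_sum_abs _ _).trans_eq (Finset.sum_congr rfl fun c _ => ?_)
        rw [abs_mul, abs_of_nonneg (temperedPosterior_nonneg h α hQ T n c)]
    _ = ∑ c ∈ feasibleTypes h α n, temperedPosterior h α Q T n c *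
          ∑ y, |hypergeometricLaw n m c y - productLaw P m y| := by
        rw [Finset.sum_comm]
        simp only [Finset.mul_sum]
    _ ≤ ∑ c ∈ feasibleTypes h α n, temperedPosterior h α Q T n c *
          (2 * ((m : ℝ) ^ 2 / n) + m * ∑ x, |typeLaw n c x - P x|) := by
        refine Finset.sum_le_sum fun c hc => mul_le_mul_of_nonneg_left ?_
          (temperedPosterior_nonneg h α hQ T n c)
        obtain ⟨hcn, hcE⟩ := mem_feasibleTypes.1 hc
        refine le_trans ?_ (add_le_add (sum_abs_hypergeometricLaw_sub_le hn hcn hm)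
          (sum_abs_productLaw_sub_le hcE.1 hP m))
        rw [← Finset.sum_add_distrib]
        exact Finset.sum_le_sum fun y _ => abs_sub_le _ _ _
    _ = _ := by
        simp only [mul_add, Finset.sum_add_distrib, ← Finset.sum_mul, hone, one_mul,
          Finset.mul_sum]
        congr 1
        refine Finset.sum_congr rfl fun c _ => Finset.sum_congr rfl fun x _ => by ring

/-- The rate constant of the collapse bound for temperatures at most `K` times the curvature. -/
noncomputable def collapseConstant (k : ℕ) (K : ℝ) : ℝ := k * √(6 * (2 * k + 1) * (1 + K)) + 2

lemma two_le_collapseConstant (k : ℕ) (K : ℝ) : 2 ≤ collapseConstant k K :=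
  le_add_of_nonneg_left (by positivity)

lemma collapseBound_of_le {k d : ℕ} {h : Fin k → Fin d → ℝ}
    (hV : tangentSpace h ≠ ⊥) {α : Fin d → ℝ} {Q P : Fin k → ℝ} {δ : ℝ} (hδ : 0 < δ)
    (hmod : IsModel h δ Q α P) {K T : ℝ} (hK : 0 ≤ K) (hT : 0 < T)
    (hTK : T ≤ K * lambdaMin h P) {n : ℕ} (hn : 3 ≤ n)
    (hnδ : (2 * k + 1) * (1 + K / δ) * Real.log n ≤ n * (δ ^ 2 / 4)) {c₀ : Fin k → ℕ}
    (hc₀ : c₀ ∈ feasibleTypes h α n) (hnear : n * klDiv (typeLaw n c₀) P ≤ 1) :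
    CollapseBound h α Q P T (collapseConstant k K) n := by
  intro m hm
  have hn0 : (0 : ℝ) < n := by exact_mod_cast (by omega : 0 < n)
  have hlog := one_le_log_of_three_le hn
  have hE : (feasibleTypes h α n).Nonempty := ⟨c₀, hc₀⟩
  have hQ := hmod.1.1
  have hP := hmod.2.1.1.1
  have hC := two_le_collapseConstant k K
  set s := √(Real.log n / n) with hs
  have hs0 : 0 ≤ s := Real.sqrt_nonneg _
  have hs2 : n * s ^ 2 = Real.log n := by
    rw [hs, Real.sq_sqrt (by positivity)]
    field_simp
  have hs1 : s ≤ 1 := by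
    rw [hs, Real.sqrt_le_iff, one_pow, div_le_one hn0]
    exact ⟨zero_le_one, by linarith [Real.log_le_sub_one_of_pos hn0]⟩
  have hm0 : (0 : ℝ) ≤ m := Nat.cast_nonneg m
  -- For `m s ≥ 1` the trivial bound on total variation suffices; for `m s < 1` the term `m²/n` is
  -- of lower order than the rate.
  rcases le_or_gt 1 (m * s) with hms | hms
  · have h1 := sum_abs_sub_le_two (temperedPredictive_nonneg h α hQ T n m)
      (productLaw_nonneg (fun x => (hP.1 x).le) m) (sum_temperedPredictive hQ T hm hE)
      (sum_productLaw hP.2 m)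
    rw [tvDist]
    nlinarith
  · have h1 := sum_abs_temperedPredictive_sub_le (α := α) hQ hP T (by omega) hm hE
    have h2 := sum_temperedPosterior_mul_dist_le hV hδ hmod hK hT hTK hn hnδ hc₀ hnear
    -- Here `m ≤ n s`, since otherwise `m s ≥ n s² = log n ≥ 1`.
    have h3 : (m : ℝ) ^ 2 / n ≤ m * s := by
      rw [div_le_iff₀ hn0, sq, mul_assoc]
      refine mul_le_mul_of_nonneg_left ?_ hm0
      by_contra! hlt
      have := mul_le_mul_of_nonneg_right hlt.le hs0
      nlinarith
    have h4 : 1 / (n : ℝ) ≤ s := by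
      rw [div_le_iff₀ hn0]
      nlinarith [mul_nonneg hn0.le (mul_nonneg hs0 (sub_nonneg.2 hs1))]
    have h5 := mul_le_mul_of_nonneg_left h2 hm0
    have h6 := mul_le_mul_of_nonneg_left h4 hm0
    have h7 : 0 ≤ k * √(6 * (2 * k + 1) * (1 + K)) * (m * s) := by positivity
    have h8 : (m : ℝ) * (2 / n) = 2 * (m * (1 / n)) := by ring
    rw [tvDist, collapseConstant, div_le_iff₀ two_pos]
    rw [← hs, mul_add, h8] at h5
    nlinarith

/-- For large samples, uniformly over the models with cells at least `δ`, every temperature at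
most `K` times the curvature gives the collapse rate. -/
lemma eventually_collapseBound {k d : ℕ} {h : Fin k → Fin d → ℝ} (hL : IsLatticeFeature h)
    (hV : tangentSpace h ≠ ⊥) {δ : ℝ} (hδ : 0 < δ) {K : ℝ} (hK : 0 ≤ K) :
    ∀ᶠ n : ℕ in atTop, ∀ (Q P : Fin k → ℝ) (α : Fin d → ℝ) (T : ℝ), IsModel h δ Q α P →
      0 < T → T ≤ K * lambdaMin h P → (feasibleTypes h α n).Nonempty →
      CollapseBound h α Q P T (collapseConstant k K) n := by
  obtain ⟨B, hB, hnear⟩ := exists_feasibleType_near hL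
  have hlogn : Tendsto (fun n : ℕ => (2 * k + 1) * (1 + K / δ) * (Real.log n / n)) atTop (𝓝 0) := by
    have := (Real.isLittleO_log_id_atTop.tendsto_div_nhds_zero.comp
      tendsto_natCast_atTop_atTop).const_mul ((2 * k + 1) * (1 + K / δ))
    simpa using this
  -- The thresholds ensure, in order, `log n ≥ 1`, positive counts after rounding, `n D ≤ 1` at the
  -- rounded type, and the bound for types with a doubled cell.
  filter_upwards [eventually_ge_atTop 3,
    (tendsto_natCast_atTop_atTop (R := ℝ)).eventually_gt_atTop (B / δ),
    (tendsto_natCast_atTop_atTop (R := ℝ)).eventually_ge_atTop (k * (B ^ 2 / δ)),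
    hlogn.eventually_le_const (show 0 < δ ^ 2 / 4 by positivity)] with n hn hn1 hn2 hn3
  intro Q P α T hmod hT hTK hE
  have hn0 : (0 : ℝ) < n := by exact_mod_cast (by omega : 0 < n)
  obtain ⟨c₀, hc₀, hdist⟩ :=
    hnear α P δ n hmod.2.1.1 hmod.2.2 ((div_lt_iff₀ hδ).1 hn1) hE
  refine collapseBound_of_le hV hδ hmod hK hT hTK hn ?_ hc₀ ?_
  · rw [← mul_div_assoc, div_le_iff₀ hn0] at hn3
    linarith
  · have h1 : klDiv (typeLaw n c₀) P ≤ k * ((B / n) ^ 2 / δ) := by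
      refine (klDiv_le_sum_sq_div (mem_feasibleTypes.1 hc₀).2.1 hmod.2.1.1.1).trans ?_
      refine (Finset.sum_le_card_nsmul _ _ ((B / n) ^ 2 / δ) fun x _ => ?_).trans_eq (by simp)
      exact div_le_div₀ (by positivity) (sq_le_sq' (by linarith [(abs_le.1 (hdist x)).1])
        (abs_le.1 (hdist x)).2) hδ (hmod.2.2 x)
    calc n * klDiv (typeLaw n c₀) P ≤ n * (k * ((B / n) ^ 2 / δ)) := by gcongr
      _ = k * (B ^ 2 / δ) / n := by field_simp
      _ ≤ 1 := (div_le_one hn0).2 hn2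

/-! ### Consequences of the collapse -/

lemma abs_sum_sub_sum_le_tvDist {S : Type*} [Fintype S] (μ ν : S → ℝ) (A : Finset S) :
    |∑ s ∈ A, μ s - ∑ s ∈ A, ν s| ≤ 2 * tvDist μ ν := by
  rw [← Finset.sum_sub_distrib, tvDist, mul_div_cancel₀ _ two_ne_zero]
  exact (Finset.abs_sum_le_sum_abs _ _).trans
    (Finset.sum_le_sum_of_subset_of_nonneg (Finset.subset_univ A) fun _ _ _ => abs_nonneg _)

/-- Tempering at `T ≥ 1` can only increase the coverage of highest-density regions. -/
lemma sum_hpdRegion_le {k d : ℕ} (h : Fin k → Fin d → ℝ) (α : Fin d → ℝ) {Q : Fin k → ℝ}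
    (hQ : ∀ x, 0 < Q x) {T : ℝ} (hT : 1 ≤ T) {n : ℕ} (hE : (feasibleTypes h α n).Nonempty)
    (t : ℝ) :
    ∑ c ∈ hpdRegion h α Q T n t, temperedPosterior h α Q T n c
      ≤ ∑ c ∈ hpdRegion h α Q T n t, temperedPosterior h α Q 1 n c := by
  classical
  have hpos := fun e => typeProb_pos hQ e
  have hrp : ∀ e, 0 < typeProb Q e ^ (1 / T) := fun e => Real.rpow_pos_of_pos (hpos e) _
  have hT0 : 0 < T := by linarith
  set R := hpdRegion h α Q T n t with hR
  have hRE : R ⊆ feasibleTypes h α n := Finset.filter_subset _ _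
  have hZ : 0 < ∑ c ∈ feasibleTypes h α n, typeProb Q c ^ (1 / T) :=
    Finset.sum_pos (fun c _ => hrp c) hE
  -- Types in `R` have larger likelihood than those outside, hence also a larger ratio `typeProb /
  -- typeProb ^ (1/T) = typeProb ^ (1 - 1/T)`.
  have hpair : ∀ c ∈ R, ∀ c' ∈ feasibleTypes h α n \ R,
      typeProb Q c ^ (1 / T) * typeProb Q c' ≤ typeProb Q c * typeProb Q c' ^ (1 / T) := by
    intro c hc c' hc'
    obtain ⟨hc'E, hc'R⟩ := Finset.mem_sdiff.1 hc'
    have h1 : t ≤ temperedPosterior h α Q T n c := (Finset.mem_filter.1 hc).2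
    have h2 : temperedPosterior h α Q T n c' < t := by
      by_contra! hle
      exact hc'R (Finset.mem_filter.2 ⟨hc'E, hle⟩)
    have h3 : typeProb Q c' ^ (1 / T) < typeProb Q c ^ (1 / T) :=
      (div_lt_div_iff_of_pos_right hZ).1 (h2.trans_le h1)
    have h4 : typeProb Q c' ≤ typeProb Q c :=
      ((Real.rpow_lt_rpow_iff (hpos c').le (hpos c).le (by positivity)).1 h3).le
    have h5 : ∀ e, typeProb Q e = typeProb Q e ^ (1 / T) * typeProb Q e ^ (1 - 1 / T) := by
      intro e
      rw [← Real.rpow_add (hpos e), add_sub_cancel, Real.rpow_one]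
    have h6 : typeProb Q c' ^ (1 - 1 / T) ≤ typeProb Q c ^ (1 - 1 / T) :=
      Real.rpow_le_rpow (hpos c').le h4 (sub_nonneg.2 ((div_le_one hT0).2 hT))
    calc typeProb Q c ^ (1 / T) * typeProb Q c'
        = typeProb Q c ^ (1 / T) * typeProb Q c' ^ (1 / T) * typeProb Q c' ^ (1 - 1 / T) := by
          rw [mul_assoc, ← h5]
      _ ≤ typeProb Q c ^ (1 / T) * typeProb Q c' ^ (1 / T) * typeProb Q c ^ (1 - 1 / T) :=
          mul_le_mul_of_nonneg_left h6 (mul_pos (hrp c) (hrp c')).le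
      _ = typeProb Q c * typeProb Q c' ^ (1 / T) := by
          rw [mul_right_comm, ← h5]
  have hcross : (∑ c ∈ R, typeProb Q c ^ (1 / T)) * ∑ c ∈ feasibleTypes h α n \ R, typeProb Q c
      ≤ (∑ c ∈ R, typeProb Q c) * ∑ c ∈ feasibleTypes h α n \ R, typeProb Q c ^ (1 / T) := by
    rw [Finset.sum_mul_sum, Finset.sum_mul_sum]
    exact Finset.sum_le_sum fun c hc => Finset.sum_le_sum fun c' hc' => hpair c hc c' hc'
  simp only [temperedPosterior, div_one, Real.rpow_one]
  -- With both normalisers split over `R` and its complement, the `R × R` products cancel and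
  -- `hcross` remains.
  rw [← Finset.sum_div, ← Finset.sum_div,
    div_le_div_iff₀ hZ (Finset.sum_pos (fun c _ => hpos c) hE),
    ← Finset.sum_sdiff hRE, ← Finset.sum_sdiff hRE (f := fun c => typeProb Q c ^ (1 / T))]
  linarith

/-! ### Temperatures and negligible events -/

lemma one_le_logTemperature {β lam0 x : ℝ} (hβ : 0 < β) (hlam0 : 0 < lam0) (hx : 0 ≤ x) :
    1 ≤ logTemperature β lam0 x :=
  le_add_of_nonneg_right
    (mul_nonneg hβ.le (Real.log_nonneg (le_add_of_nonneg_right (div_nonneg hx hlam0.le))))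

lemma logTemperature_le {β lam0 x : ℝ} (hβ : 0 < β) (hlam0 : 0 < lam0) (hx : 0 ≤ x) :
    logTemperature β lam0 x ≤ 1 + β / lam0 * x := by
  have h0 := div_nonneg hx hlam0.le
  have h1 := Real.log_le_sub_one_of_pos (show 0 < 1 + x / lam0 by linarith)
  have h2 := mul_le_mul_of_nonneg_left h1 hβ.le
  rw [logTemperature, div_mul_eq_mul_div, mul_div_assoc]
  linarith

lemma logTemperature_div_mem_Icc {β lam0 l u x : ℝ} (hβ : 0 < β) (hlam0 : 0 < lam0) (hl : 0 < l)
    (hx : x ∈ Set.Icc l u) :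
    logTemperature β lam0 x / x ∈ Set.Icc (1 / (|u| + 1)) (1 / l + β / lam0) := by
  have hx0 : 0 < x := hl.trans_le hx.1
  have h1 := one_le_logTemperature hβ hlam0 hx0.le
  constructor
  · exact div_le_div₀ (by linarith) h1 hx0 (by linarith [hx.2, le_abs_self u])
  · rw [div_le_iff₀ hx0, add_mul]
    have h2 : 1 ≤ 1 / l * x := by
      rw [one_div_mul_eq_div, one_le_div hl]
      exact hx.1
    linarith [logTemperature_le hβ hlam0 hx0.le]

lemma UniformlyNegligible.mono {ι : Type*} {Ω : ι → ℕ → Type*} [∀ i n, MeasurableSpace (Ω i n)]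
    {ℙ : ∀ i n, Measure (Ω i n)} {A B : ∀ i n, Set (Ω i n)} (hB : UniformlyNegligible ℙ B)
    (hAB : ∀ᶠ n in atTop, ∀ i, A i n ⊆ B i n) : UniformlyNegligible ℙ A := by
  intro η hη
  filter_upwards [hB η hη, hAB] with n hn hn' i
  exact (measure_mono (hn' i)).trans (hn i)

lemma UniformlyNegligible.union {ι : Type*} {Ω : ι → ℕ → Type*} [∀ i n, MeasurableSpace (Ω i n)]
    {ℙ : ∀ i n, Measure (Ω i n)} {A B : ∀ i n, Set (Ω i n)} (hA : UniformlyNegligible ℙ A)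
    (hB : UniformlyNegligible ℙ B) : UniformlyNegligible ℙ fun i n => A i n ∪ B i n := by
  intro η hη
  have hη2 : 0 < η / 2 := ENNReal.half_pos hη.ne'
  filter_upwards [hA _ hη2, hB _ hη2] with n hn hn' i
  calc ℙ i n (A i n ∪ B i n) ≤ ℙ i n (A i n) + ℙ i n (B i n) := measure_union_le _ _
    _ ≤ η / 2 + η / 2 := add_le_add (hn i) (hn' i)
    _ = η := ENNReal.add_halves η

/-- A consistent estimator of the curvature is eventually positive and at most twice the
curvature. -/
lemma pos_and_le_two_mul_of_abs_sub_lt {k d : ℕ} {h : Fin k → Fin d → ℝ}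
    (hV : tangentSpace h ≠ ⊥) {P : Fin k → ℝ} (hP : P ∈ openSimplex k) {x : ℝ}
    (hx : ¬ 1 ≤ |x - lambdaMin h P|) : 0 < x ∧ x ≤ 2 * lambdaMin h P := by
  have h1 := one_le_lambdaMin hV hP
  have h2 := abs_lt.1 (not_le.1 hx)
  constructor <;> linarith [h2.1, h2.2]

/-- Since `log(1 + y) ≤ y`, the temperature is at most affine in `x ≤ 2 λ_min`, and `λ_min ≥ 1`
absorbs the constant term. -/
lemma logTemperature_le_mul_lambdaMin {k d : ℕ} {h : Fin k → Fin d → ℝ}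
    (hV : tangentSpace h ≠ ⊥) {P : Fin k → ℝ} (hP : P ∈ openSimplex k) {β lam0 x : ℝ}
    (hβ : 0 < β) (hlam0 : 0 < lam0) (hx : ¬ 1 ≤ |x - lambdaMin h P|) :
    logTemperature β lam0 x ≤ (1 + 2 * (β / lam0)) * lambdaMin h P := by
  obtain ⟨h1, h2⟩ := pos_and_le_two_mul_of_abs_sub_lt hV hP hx
  have h3 := mul_le_mul_of_nonneg_left h2 (div_pos hβ hlam0).le
  linarith [logTemperature_le hβ hlam0 h1.le, one_le_lambdaMin hV hP]

/-- Needed because the collapse bound only covers horizons `m ≤ n`; it holds since `√(log n / n) ≥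
1/n` for `n ≥ 3`. -/
lemma eventually_le_of_tendsto_mul_sqrt_log {m : ℕ → ℕ}
    (hm : Tendsto (fun n : ℕ => (m n : ℝ) * √(Real.log n / n)) atTop (𝓝 0)) :
    ∀ᶠ n in atTop, m n ≤ n := by
  filter_upwards [hm.eventually_le_const one_pos, eventually_ge_atTop 3] with n hn hn3
  have hn0 : (0 : ℝ) < n := by exact_mod_cast (by omega : 0 < n)
  have hn1 : (1 : ℝ) ≤ n := by exact_mod_cast (by omega : 1 ≤ n)
  have h1 : 1 / (n : ℝ) ≤ √(Real.log n / n) := by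
    refine Real.le_sqrt_of_sq_le ?_
    calc (1 / (n : ℝ)) ^ 2 ≤ 1 / n := pow_le_of_le_one (by positivity)
          ((div_le_one hn0).2 hn1) two_ne_zero
      _ ≤ _ := div_le_div_of_nonneg_right (one_le_log_of_three_le hn3) hn0.le
  have h2 : (m n : ℝ) * (1 / n) ≤ 1 := (mul_le_mul_of_nonneg_left h1 (Nat.cast_nonneg _)).trans hn
  rw [mul_one_div, div_le_one hn0] at h2
  exact_mod_cast h2

end Tempering

/-! ### The main theorem -/

theorem mainTheorem10 :
    -- Every temperature comparable to the estimated curvature gives the collapse rate.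
    (∀ (k : ℕ) (l u a b : ℝ), 0 < l → 0 < a →
      ∃ C : ℝ, 0 < C ∧
        ∀ (d : ℕ) (h : Fin k → Fin d → ℝ) (δ : ℝ),
          Tempering.IsLatticeFeature h → Tempering.tangentSpace h ≠ ⊥ → 0 < δ →
        ∀ (ι : Type*) (Q P : ι → Fin k → ℝ) (α : ι → Fin d → ℝ),
          (∀ i, Tempering.IsModel h δ (Q i) (α i) (P i)) →
          (∀ i, Tempering.lambdaMin h (P i) ∈ Set.Icc l u) →
        ∀ (Ω : ι → ℕ → Type*) [∀ i n, MeasurableSpace (Ω i n)]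
          (ℙ : ∀ i n, Measure (Ω i n)) [∀ i n, IsProbabilityMeasure (ℙ i n)]
          (lamHat T : ∀ i n, Ω i n → ℝ),
          Tempering.IsConsistent ℙ lamHat (fun i => Tempering.lambdaMin h (P i)) →
          Tempering.UniformlyNegligible ℙ
            (fun i n => {ω | T i n ω / lamHat i n ω ∉ Set.Icc a b}) →
          Tempering.UniformlyNegligible ℙ
            (fun i n => {ω | (Tempering.feasibleTypes h (α i) n).Nonempty ∧
              ¬ Tempering.CollapseBound h (α i) (Q i) (P i) (T i n ω) C n})) ∧
    -- The logarithmic temperature.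
    (∀ (k : ℕ) (β lam0 : ℝ), 0 < β → 0 < lam0 →
      -- It is comparable to the curvature over every bounded range of curvatures.
      (∀ l u : ℝ, 0 < l → ∃ a b : ℝ, 0 < a ∧
        ∀ x ∈ Set.Icc l u, Tempering.logTemperature β lam0 x / x ∈ Set.Icc a b) ∧
      ∃ C : ℝ, 0 < C ∧
        ∀ (d : ℕ) (h : Fin k → Fin d → ℝ) (δ : ℝ),
          Tempering.IsLatticeFeature h → Tempering.tangentSpace h ≠ ⊥ → 0 < δ →
        ∀ (ι : Type*) (Q P : ι → Fin k → ℝ) (α : ι → Fin d → ℝ),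
          (∀ i, Tempering.IsModel h δ (Q i) (α i) (P i)) →
        ∀ (Ω : ι → ℕ → Type*) [∀ i n, MeasurableSpace (Ω i n)]
          (ℙ : ∀ i n, Measure (Ω i n)) [∀ i n, IsProbabilityMeasure (ℙ i n)]
          (lamHat : ∀ i n, Ω i n → ℝ),
          Tempering.IsConsistent ℙ lamHat (fun i => Tempering.lambdaMin h (P i)) →
          -- Rates are stable across all curvatures.
          Tempering.UniformlyNegligible ℙ
            (fun i n => {ω | (Tempering.feasibleTypes h (α i) n).Nonempty ∧
              ¬ Tempering.CollapseBound h (α i) (Q i) (P i)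
                (Tempering.logTemperature β lam0 (lamHat i n ω)) C n}) ∧
          -- Predictive calibration: tempered predictive probabilities of events agree
          -- asymptotically with the actual conditional ones and with those under the benchmark.
          (∀ m : ℕ → ℕ,
            Tendsto (fun n : ℕ => (m n : ℝ) * Real.sqrt (Real.log n / n)) atTop (𝓝 0) →
            ∀ ε : ℝ, 0 < ε →
            Tempering.UniformlyNegligible ℙ
              (fun i n => {ω | (Tempering.feasibleTypes h (α i) n).Nonempty ∧
                ¬ ∀ S : Finset (Fin (m n) → Fin k),
                  |∑ y ∈ S, Tempering.temperedPredictive h (α i) (Q i)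
                      (Tempering.logTemperature β lam0 (lamHat i n ω)) n (m n) y
                    - ∑ y ∈ S, Tempering.temperedPredictive h (α i) (Q i) 1 n (m n) y| ≤ ε ∧
                  |∑ y ∈ S, Tempering.temperedPredictive h (α i) (Q i)
                      (Tempering.logTemperature β lam0 (lamHat i n ω)) n (m n) y
                    - ∑ y ∈ S, Tempering.productLaw (P i) (m n) y| ≤ ε})) ∧
          -- Credible regions: the actual conditional coverage of a highest-density region of the
          -- tempered posterior is at least its nominal level.
          Tempering.UniformlyNegligible ℙ
            (fun i n => {ω | (Tempering.feasibleTypes h (α i) n).Nonempty ∧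
              ¬ ∀ t : ℝ,
                ∑ c ∈ Tempering.hpdRegion h (α i) (Q i)
                    (Tempering.logTemperature β lam0 (lamHat i n ω)) n t,
                  Tempering.temperedPosterior h (α i) (Q i)
                    (Tempering.logTemperature β lam0 (lamHat i n ω)) n c
                ≤ ∑ c ∈ Tempering.hpdRegion h (α i) (Q i)
                    (Tempering.logTemperature β lam0 (lamHat i n ω)) n t,
                  Tempering.temperedPosterior h (α i) (Q i) 1 n c})) := by
  refine ⟨fun k l u a b hl ha => ?_, fun k β lam0 hβ hlam0 => ⟨fun l u hl => ?_, ?_⟩⟩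
  -- Outside the two negligible events `T ≤ b λ̂` and `λ̂ ≤ 2 λ_min`; the absolute value makes `K`
  -- visibly nonnegative.
  · refine ⟨Tempering.collapseConstant k (2 * |b|),
      two_pos.trans_le (Tempering.two_le_collapseConstant _ _), ?_⟩
    intro d h δ hL hV hδ ι Q P α hmod _ Ω _ ℙ _ lamHat T hcons hT
    refine ((hcons 1 one_pos).union hT).mono ?_
    filter_upwards [Tempering.eventually_collapseBound hL hV hδ
      (show 0 ≤ 2 * |b| by positivity)] with n hn i ω hω
    by_contra hmem
    rw [Set.mem_union, not_or] at hmem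
    obtain ⟨hest, hratio⟩ := hmem
    obtain ⟨hpos, hle⟩ :=
      Tempering.pos_and_le_two_mul_of_abs_sub_lt hV (hmod i).2.1.1.1 hest
    obtain ⟨h1, h2⟩ := Set.mem_Icc.1 (not_not.1 hratio)
    refine hω.2 (hn _ _ _ _ (hmod i) ?_ ?_ hω.1)
    · exact (mul_pos ha hpos).trans_le ((le_div_iff₀ hpos).1 h1)
    · calc T i n ω ≤ b * lamHat i n ω := (div_le_iff₀ hpos).1 h2
        _ ≤ |b| * (2 * Tempering.lambdaMin h (P i)) :=
          mul_le_mul (le_abs_self b) hle hpos.le (abs_nonneg b)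
        _ = _ := by ring
  · exact ⟨1 / (|u| + 1), 1 / l + β / lam0, by positivity,
      fun x hx => Tempering.logTemperature_div_mem_Icc hβ hlam0 hl hx⟩
  · set K := 1 + 2 * (β / lam0)
    have hK1 : 1 ≤ K := le_add_of_nonneg_right (by positivity)
    have hK : 0 ≤ K := zero_le_one.trans hK1
    have hC := Tempering.two_le_collapseConstant k K
    refine ⟨Tempering.collapseConstant k K, two_pos.trans_le hC, ?_⟩
    intro d h δ hL hV hδ ι Q P α hmod Ω _ ℙ _ lamHat hcons
    have hbound := Tempering.eventually_collapseBound hL hV hδ hK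
    have hPs := fun i => (hmod i).2.1.1.1
    have hT1 : ∀ i n ω, ¬ 1 ≤ |lamHat i n ω - Tempering.lambdaMin h (P i)| →
        1 ≤ Tempering.logTemperature β lam0 (lamHat i n ω) := fun i n ω hest =>
      Tempering.one_le_logTemperature hβ hlam0
        (Tempering.pos_and_le_two_mul_of_abs_sub_lt hV (hPs i) hest).1.le
    refine ⟨(hcons 1 one_pos).mono ?_, fun m hm ε hε => (hcons 1 one_pos).mono ?_,
      (hcons 1 one_pos).mono ?_⟩
    · filter_upwards [hbound] with n hn i ω hω
      by_contra hest
      exact hω.2 (hn _ _ _ _ (hmod i) (zero_lt_one.trans_le (hT1 i n ω hest))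
        (Tempering.logTemperature_le_mul_lambdaMin hV (hPs i) hβ hlam0 hest) hω.1)
    -- The quarter: two collapse bounds are added, and each is doubled in passing from total
    -- variation to events.
    · have hrate : ∀ᶠ n : ℕ in atTop,
          Tempering.collapseConstant k K * ((m n : ℝ) * √(Real.log n / n)) ≤ ε / 4 := by
        have := hm.const_mul (Tempering.collapseConstant k K)
        rw [mul_zero] at this
        exact this.eventually_le_const (by positivity)
      filter_upwards [hbound, hrate, Tempering.eventually_le_of_tendsto_mul_sqrt_log hm]
        with n hn hrn hmn i ω hω
      by_contra hest
      refine hω.2 fun S => ?_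
      have h1 := (hn _ _ _ _ (hmod i) (zero_lt_one.trans_le (hT1 i n ω hest))
        (Tempering.logTemperature_le_mul_lambdaMin hV (hPs i) hβ hlam0 hest) hω.1 _ hmn).trans hrn
      -- The actual conditional law is the case `T = 1`, admissible because `1 ≤ K λ_min`.
      have h2 := (hn _ _ _ 1 (hmod i) one_pos
        (one_le_mul_of_one_le_of_one_le hK1 (Tempering.one_le_lambdaMin hV (hPs i))) hω.1 _
        hmn).trans hrn
      have h3 := (Tempering.abs_sum_sub_sum_le_tvDist _ _ S).trans
        (mul_le_mul_of_nonneg_left h1 zero_le_two)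
      have h4 := (Tempering.abs_sum_sub_sum_le_tvDist _ _ S).trans
        (mul_le_mul_of_nonneg_left h2 zero_le_two)
      rw [abs_sub_comm] at h4
      exact ⟨(abs_sub_le _ _ _).trans ((add_le_add h3 h4).trans (by linarith)),
        h3.trans (by linarith)⟩
    · refine Eventually.of_forall fun n i ω hω => ?_
      by_contra hest
      exact hω.2 fun t =>
        Tempering.sum_hpdRegion_le h (α i) (hmod i).1.1 (hT1 i n ω hest) hω.1 t
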